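/- For a set $Y$ let $\mathcal D(Y)$ be the set of finitely supported probability distributions on $Y$, and let $\delta_y$ denote the Dirac distribution at $y$. A subdistribution on a set $X$ is identified with a distribution on $X+\mathbf 1$, where $\mathbf 1=\{\star\}$. Let $\mathcal C(Y)$ be the set of all non-empty convex subsets of $\mathcal D(Y)$ that are the convex closure $cc(F)$ of a finite set $F\subseteq\mathcal D(Y)$. A set $S\in\mathcal C(X+\mathbf 1)$ is $\bot$-closed if, for every $\varphi\in S$, every $\psi\in\mathcal D(X+\mathbf 1)$ with $\psi(x)\le\varphi(x)$ for all $x\in X$ belongs to $S$. Let $\mathcal C^{\downarrow}$ be the following monad on $\mathbf{Set}$. - $\mathcal C^{\downarrow}(X)$ is the set of $\bot$-closed elements of $\mathcal C(X+\mathbf 1)$. - For $f:X\to Y$, $\mathcal C^{\downarrow}(f)(S)$ is the set of push-forwards along $f+\mathbf 1$ of the elements of $S$. - The unit is $\eta_X(x)=cc\{\delta_x,\delta_\star\}=\{p\,x+(1-p)\,\star\mid p\in[0,1]\}$. - The multiplication is $\mu_X(S)=\bigcup_{\Phi\in S}\mathrm{WMS}(\Phi^{\star})$. Here $\Phi^{\star}\in\mathcal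 D(\mathcal C(X+\mathbf 1))$ is the push-forward of $\Phi\in\mathcal D(\mathcal C^{\downarrow}(X)+\mathbf 1)$ along the map that fixes each element of $\mathcal C^{\downarrow}(X)$ and sends the extra point to $\{\delta_\star\}$, and $\mathrm{WMS}(\sum_i p_iS_i)=\{\sum_i p_i\varphi_i\mid \varphi_i\in S_i\text{ for each } i\}$ (distinct $S_i$, $p_i>0$). Let $\mathbf A(\mathtt{ET}_{CS}^{\bot})$ be the category of convex semilattices with bottom. Its objects are sets with binary operations $\oplus$ and $+_p$ ($p\in(0,1)$) and a constant $\star$ satisfying, for all $p,q\in(0,1)$, $$x\oplus(y\oplus z)=(x\oplus y)\oplus z,\quad x\oplus y=y\oplus x,\quad x\oplus x=x,$$ $$(x+_qy)+_pz=x+_{pq}\bigl(y+_{\frac{p(1-q)}{1-pq}}z\bigr),\quad x+_py=y+_{1-p}x,\quad x+_px=x,$$ $$x+_p(y\oplus z)=(x+_py)\oplus(x+_pz),\quad x\oplus\star=x,$$ and its morphisms are the functions preserving all the operations. **Theorem.** The monad $\mathcal C^{\downarrow}$ is presented by the equational theory of convex semilattices with bottom: there is an isomorphism of categories $$\mathbf{EM}(\mathcal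 C^{\downarrow})\cong\mathbf A(\mathtt{ET}_{CS}^{\bot})$$ between the Eilenberg--Moore category of $\mathcal C^{\downarrow}$ and the category of convex semilattices with bottom, and it commutes with the forgetful functors to $\mathbf{Set}$. -/

import Mathlib

universe u v w

open CategoryTheory

noncomputable section

namespace ConvexSets

open Convexity

/-! ## Finitely supported distributions and convex sets of them -/

/-- Finitely supported probability distributions on `X`. -/
abbrev Dist (X : Type u) : Type u := StdSimplex ℝ X

/-- The Dirac distribution. -/
abbrev dirac {X : Type u} (x : X) : Dist X := StdSimplex.single x

/-- `∑ i, Φ i • φ i`, written as a function of the family `φ` of distributions. -/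
abbrev mix {I : Type u} {X : Type v} (Φ : Dist I) (φ : I → Dist X) : Dist X :=
  Φ.iConvexComb φ

/-- Convex closure of a set of distributions. -/
abbrev cc {X : Type u} (S : Set (Dist X)) : Set (Dist X) := Convexity.convexHull ℝ S

/-- Non-empty finitely generated convex sets of distributions on `X`. -/
@[ext]
structure CSet (X : Type u) : Type u where
  carrier : Set (Dist X)
  nonempty : carrier.Nonempty
  convex : IsConvexSet ℝ carrier
  finGen : ∃ F : Set (Dist X), F.Finite ∧ carrier = cc F

/-- The convex closure of a non-empty finite set of distributions. -/
def CSet.ofFinite {X : Type u} (F : Set (Dist X)) (hF : F.Finite) (hne : F.Nonempty) :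
    CSet X where
  carrier := cc F
  nonempty := convexHull_nonempty.2 hne
  convex := IsConvexSet.convexHull
  finGen := ⟨F, hF, rfl⟩

/-- Action on functions: the set of push-forwards. -/
def CSet.map {X : Type u} {Y : Type v} (f : X → Y) (S : CSet X) : CSet Y where
  carrier := (StdSimplex.map f) '' S.carrier
  nonempty := S.nonempty.image _
  convex := S.convex.image (StdSimplex.isAffineMap_map ℝ f)
  finGen := by
    obtain ⟨F, hF, h⟩ := S.finGen
    exact ⟨_, hF.image _, by rw [h, (StdSimplex.isAffineMap_map ℝ f).image_convexHull]⟩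

/-- Weighted Minkowski sum of a distribution `Φ = ∑ pᵢ Sᵢ` over convex sets: all the distributions
`∑ pᵢ φᵢ` with `φᵢ ∈ Sᵢ` for each `Sᵢ` in the support of `Φ`. -/
def wms {X : Type u} (Φ : Dist (CSet X)) : Set (Dist X) :=
  {ψ | ∃ φ : CSet X → Dist X, (∀ U, Φ.weights U ≠ 0 → φ U ∈ U.carrier) ∧ ψ = mix Φ φ}

/-! ### Auxiliary facts: the multiplication is well defined -/

lemma mix_weights {I : Type u} {X : Type v} (Φ : Dist I) (φ : I → Dist X) (x : X) :
    (mix Φ φ).weights x = Φ.weights.sum (fun i r => r * (φ i).weights x) := by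
  simp only [mix, StdSimplex.iConvexComb, StdSimplex.weights_sConvexComb, StdSimplex.weights_map]
  rw [Finsupp.sum_mapDomain_index (by simp) (by intros; simp [add_smul])]
  simp [Finsupp.sum, Finsupp.finsetSum_apply]

lemma mix_mix {K : Type u} {I : Type v} {X : Type w} (Θ : Dist K) (g : K → Dist I)
    (φ : I → Dist X) : mix Θ (fun j => mix (g j) φ) = mix (mix Θ g) φ :=
  Convexity.iConvexComb_assoc _ _ _

lemma mix_weights_ne {I : Type u} {X : Type v} (Φ : Dist I) (φ : I → Dist X) (i : I) (x : X)
    (hi : Φ.weights i ≠ 0) (hx : (φ i).weights x ≠ 0) : (mix Φ φ).weights x ≠ 0 := by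
  rw [mix_weights]
  apply ne_of_gt
  refine Finset.sum_pos' (fun j _ => mul_nonneg (Φ.nonneg j) ((φ j).nonneg x)) ⟨i, by simpa, ?_⟩
  exact mul_pos (lt_of_le_of_ne (Φ.nonneg i) hi.symm) (lt_of_le_of_ne ((φ i).nonneg x) hx.symm)

lemma exists_of_mix_weights_ne {I : Type u} {X : Type v} (Φ : Dist I) (φ : I → Dist X) (x : X)
    (h : (mix Φ φ).weights x ≠ 0) : ∃ i, Φ.weights i ≠ 0 ∧ (φ i).weights x ≠ 0 := by
  rw [mix_weights] at h
  obtain ⟨i, hi, hx⟩ := Finset.exists_ne_zero_of_sum_ne_zero h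
  exact ⟨i, by simpa using hi, right_ne_zero_of_mul hx⟩

lemma map_eq_mix {I : Type u} {X : Type v} (Φ : Dist I) (f : I → X) :
    Φ.map f = mix Φ (fun i => dirac (f i)) := by
  ext x
  rw [mix_weights]
  classical
  simp [Finsupp.mapDomain, Finsupp.sum, Finsupp.finsetSum_apply, Finsupp.single_apply]

lemma mix_dirac {I : Type u} (Φ : Dist I) : mix Φ dirac = Φ := by
  have := map_eq_mix Φ id
  simpa using this.symm

/-- Disintegration along `π`: the mixture of a family over `Ξ` is a mixture over the push-forward of
fibrewise mixtures. -/
lemma exists_merge {P : Type u} {J : Type v} {X : Type w} (Ξ : Dist P) (π : P → J)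
    (k : P → Dist X) (V : J → Set (Dist X)) (hV : ∀ j, IsConvexSet ℝ (V j))
    (hk : ∀ p, Ξ.weights p ≠ 0 → k p ∈ V (π p)) :
    ∃ h : J → Dist X, (∀ j, (Ξ.map π).weights j ≠ 0 → h j ∈ V j) ∧
      mix Ξ k = mix (Ξ.map π) h := by
  classical
  obtain ⟨p₀⟩ := Ξ.nonempty
  let R : J → Dist P := fun j =>
    if hj : ∃ p ∈ π ⁻¹' {j}, Ξ.weights p ≠ 0 then Ξ.restrict (π ⁻¹' {j}) hj else dirac p₀
  have hpos : ∀ j, (Ξ.map π).weights j ≠ 0 → ∃ p ∈ π ⁻¹' {j}, Ξ.weights p ≠ 0 := by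
    intro j hj
    rw [map_eq_mix] at hj
    obtain ⟨p, hp, h2⟩ := exists_of_mix_weights_ne _ _ _ hj
    refine ⟨p, ?_, hp⟩
    by_contra hne
    exact h2 (by simp at hne; simp [hne])
  have hR : mix (Ξ.map π) R = Ξ := by
    ext p
    rw [mix_weights, StdSimplex.weights_map,
      Finsupp.sum_mapDomain_index (by simp) (by intros; ring)]
    by_cases hp : Ξ.weights p = 0
    · rw [hp]
      refine Finset.sum_eq_zero fun q hq => ?_
      have hj : ∃ p ∈ π ⁻¹' {π q}, Ξ.weights p ≠ 0 := ⟨q, rfl, by simpa using hq⟩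
      simp only [R, dif_pos hj, StdSimplex.weights_restrict]
      simp [Finsupp.filter_apply, hp]
    · have hj : ∃ q ∈ π ⁻¹' {π p}, Ξ.weights q ≠ 0 := ⟨p, rfl, hp⟩
      set c : ℝ := (Ξ.weights.filter (· ∈ π ⁻¹' {π p})).sum fun _ k => k with hc
      have hc' : c = Ξ.weights.sum fun q r => if π q = π p then r else 0 := by
        simp only [hc, Finsupp.sum, Finsupp.support_filter, Finset.sum_filter]
        refine Finset.sum_congr rfl fun q _ => ?_
        by_cases h : π q = π p <;> simp [h]
      have hc0 : c ≠ 0 := by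
        rw [hc']
        apply ne_of_gt
        refine Finset.sum_pos' (fun q _ => ?_) ⟨p, by simpa using hp, ?_⟩
        · dsimp only
          split_ifs
          · exact Ξ.nonneg q
          · exact le_rfl
        · simpa using lt_of_le_of_ne (Ξ.nonneg p) (Ne.symm hp)
      have : ∀ q ∈ Ξ.weights.support, Ξ.weights q * (R (π q)).weights p =
          (if π q = π p then Ξ.weights q else 0) * (c⁻¹ * Ξ.weights p) := by
        intro q hq
        by_cases h : π q = π p
        · simp only [h, R, dif_pos hj, StdSimplex.weights_restrict, if_true, ← hc]
          simp
        · have hj' : ∃ p ∈ π ⁻¹' {π q}, Ξ.weights p ≠ 0 := ⟨q, rfl, by simpa using hq⟩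
          simp only [R, dif_pos hj', StdSimplex.weights_restrict, h, if_false]
          simp [Ne.symm h]
      rw [Finsupp.sum, Finset.sum_congr rfl this, ← Finset.sum_mul]
      change (Ξ.weights.sum fun q r => if π q = π p then r else 0) * _ = _
      rw [← hc', mul_inv_cancel_left₀ hc0]
  refine ⟨fun j => mix (R j) k, fun j hj => ?_, ?_⟩
  · have hj' := hpos j hj
    refine (hV j).iConvexComb_mem fun p hp => ?_
    simp only [R, dif_pos hj', StdSimplex.weights_restrict] at hp
    have hp1 : π p = j := by
      by_contra h
      exact hp (by simp [h])
    have hp2 : Ξ.weights p ≠ 0 := by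
      intro h
      exact hp (by simp [Finsupp.filter_apply, h])
    exact hp1 ▸ hk p hp2
  · rw [mix_mix, hR]

/-- All mixtures `∑ i, Φ i • φ i` with `φ i ∈ k i` on the support of `Φ`. -/
def mixes {I : Type u} {X : Type v} (k : I → CSet X) (Φ : Dist I) : Set (Dist X) :=
  {ψ | ∃ φ : I → Dist X, (∀ i, Φ.weights i ≠ 0 → φ i ∈ (k i).carrier) ∧ ψ = mix Φ φ}

lemma wms_map {I : Type u} {X : Type v} (k : I → CSet X) (Φ : Dist I) :
    wms (Φ.map k) = mixes k Φ := by
  ext ψ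
  constructor
  · rintro ⟨φ, h, rfl⟩
    refine ⟨fun i => φ (k i), fun i hi => h _ ?_, by simp [mix]⟩
    rw [map_eq_mix]
    exact mix_weights_ne _ _ i _ hi (by simp)
  · rintro ⟨φ, h, rfl⟩
    exact exists_merge Φ k φ (fun U => U.carrier) (fun U => U.convex) h

/-- Mixing twice, with the inner family depending on the outer index, can be done with an inner
family that does not depend on it. -/
lemma exists_merge₂ {K : Type u} {I : Type u} {X : Type v} (Θ : Dist K) (g : K → Dist I)
    (φ : K → I → Dist X) (V : I → Set (Dist X)) (hV : ∀ i, IsConvexSet ℝ (V i))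
    (h : ∀ j i, Θ.weights j ≠ 0 → (g j).weights i ≠ 0 → φ j i ∈ V i) :
    ∃ φ' : I → Dist X, (∀ i, (mix Θ g).weights i ≠ 0 → φ' i ∈ V i) ∧
      mix Θ (fun j => mix (g j) (φ j)) = mix (mix Θ g) φ' := by
  let Ξ : Dist (K × I) := mix Θ fun j => (g j).map (fun i => (j, i))
  have e1 : mix Θ (fun j => mix (g j) (φ j)) = mix Ξ (Function.uncurry φ) :=
    Convexity.iConvexComb_assoc' _ _ _
  have e2 : Ξ.map Prod.snd = mix Θ g := by
    simp only [Ξ, mix, Convexity.map_iConvexComb, Function.comp_def, StdSimplex.map_map]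
    congr 1
    funext j
    exact StdSimplex.map_id _
  obtain ⟨φ', h1, h2⟩ := exists_merge Ξ Prod.snd (Function.uncurry φ) V hV (by
    rintro ⟨j, i⟩ hp
    obtain ⟨j', hj', hq⟩ := exists_of_mix_weights_ne _ _ _ hp
    rw [map_eq_mix] at hq
    obtain ⟨i', hi', hq⟩ := exists_of_mix_weights_ne _ _ _ hq
    have : (j', i') = (j, i) := by
      by_contra hne
      exact hq (by classical simp [hne])
    cases this
    exact h _ _ hj' hi')
  rw [e2] at h1 h2
  exact ⟨φ', h1, e1.trans h2⟩

lemma mix_duple {X : Type v} {a b : ℝ} (ha : 0 ≤ a) (hb : 0 ≤ b) (hab : a + b = 1)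
    (f : ULift.{u} (Fin 2) → Dist X) :
    mix (StdSimplex.duple (ULift.up (0 : Fin 2)) (ULift.up 1) ha hb hab) f =
      convexCombPair a b ha hb hab (f ⟨0⟩) (f ⟨1⟩) := by
  simp [mix, StdSimplex.iConvexComb, convexCombPair]

lemma convex_mixes {I : Type u} {X : Type v} (k : I → CSet X) (S : Set (Dist I))
    (hS : IsConvexSet ℝ S) : IsConvexSet ℝ (⋃ Φ ∈ S, mixes k Φ) := by
  refine IsConvexSet.of_convexCombPair_mem fun a b ha hb hab x hx y hy => ?_
  simp only [Set.mem_iUnion, exists_prop] at hx hy ⊢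
  obtain ⟨Φ, hΦ, φ, hφ, rfl⟩ := hx
  obtain ⟨Ψ, hΨ, χ, hχ, rfl⟩ := hy
  refine ⟨convexCombPair a b ha hb hab Φ Ψ, hS.convexCombPair_mem hΦ hΨ ha hb hab, ?_⟩
  obtain ⟨φ', h1, h2⟩ := exists_merge₂
    (StdSimplex.duple (ULift.up (0 : Fin 2)) (ULift.up 1) ha hb hab)
    (fun j => ![Φ, Ψ] j.down) (fun j => ![φ, χ] j.down)
    (fun i => (k i).carrier) (fun i => (k i).convex) (by
      rintro ⟨j⟩ i _ hi
      fin_cases j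
      · exact hφ i hi
      · exact hχ i hi)
  have e := mix_duple (X := I) ha hb hab
  have e' := mix_duple (X := X) ha hb hab
  rw [e] at h1
  refine ⟨φ', h1, ?_⟩
  rw [e, e'] at h2
  exact h2

lemma isAffineMap_update {I : Type u} [DecidableEq I] {X : Type v} (Φ : Dist I)
    (φ : I → Dist X) (j : I) :
    IsAffineMap ℝ (fun y => mix Φ (Function.update φ j y)) := by
  constructor
  intro w
  rw [sConvexComb_map, mix, Convexity.iConvexComb_comm]
  congr 1
  funext i
  by_cases h : i = j
  · subst h; simp
  · simp [h]

lemma finGen_mixes {I : Type u} {X : Type v} (k : I → CSet X) (Φ : Dist I) :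
    ∃ F : Set (Dist X), F.Finite ∧ mixes k Φ = cc F := by
  classical
  choose G hGf hG using fun i => (k i).finGen
  have hconv : IsConvexSet ℝ (mixes k Φ) := by
    have := convex_mixes k {Φ} IsConvexSet.singleton
    simpa using this
  choose d hd using fun i => (k i).nonempty
  -- the selections that are arbitrary outside of the support are normalised to `d`
  let N : ((i : Φ.weights.support) → Dist X) → I → Dist X :=
    fun s i => if hi : i ∈ Φ.weights.support then s ⟨i, hi⟩ else d i
  let F : Set (Dist X) := (fun s => mix Φ (N s)) '' (Set.univ.pi fun i => G i.1)
  have hFin : F.Finite := (Set.Finite.pi' fun i => hGf i.1).subset (by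
    intro s hs i; exact hs i (Set.mem_univ _)) |>.image _
  refine ⟨F, hFin, Set.Subset.antisymm ?_ ?_⟩
  · have key : ∀ T : Finset I, ∀ φ : I → Dist X,
        (∀ i ∈ T, φ i ∈ cc (G i)) → (∀ i ∉ T, Φ.weights i ≠ 0 → φ i ∈ G i) →
        mix Φ φ ∈ cc F := by
      intro T
      induction T using Finset.induction_on with
      | empty =>
        intro φ _ h
        apply subset_convexHull_self
        refine ⟨fun i => φ i.1, fun i _ => h _ (by simp) (Finsupp.mem_support_iff.1 i.2), ?_⟩
        refine Convexity.iConvexComb_congr fun i hi => ?_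
        simp [N, hi]
      | insert j T hj ih =>
        intro φ h1 h2
        have hsub : G j ⊆ (fun y => mix Φ (Function.update φ j y)) ⁻¹' cc F := by
          intro y hy
          refine ih _ (fun i hi => ?_) (fun i hi hi' => ?_)
          · have : i ≠ j := by rintro rfl; exact hj hi
            rw [Function.update_of_ne this]
            exact h1 i (Finset.mem_insert_of_mem hi)
          · by_cases hij : i = j
            · subst hij; simpa using hy
            · rw [Function.update_of_ne hij]
              exact h2 i (by simp [hij, hi]) hi'
        have := Convexity.convexHull_min hsub
          (IsConvexSet.convexHull.preimage (isAffineMap_update Φ φ j))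
          (h1 j (Finset.mem_insert_self _ _))
        simpa using this
    rintro _ ⟨φ, hφ, rfl⟩
    refine key Φ.weights.support φ (fun i hi => ?_) (fun i hi hi' => ?_)
    · rw [← hG]; exact hφ i (by simpa using hi)
    · exact absurd (by simpa using hi) hi'
  · refine Convexity.convexHull_min ?_ hconv
    rintro _ ⟨s, hs, rfl⟩
    refine ⟨_, fun i hi => ?_, rfl⟩
    have hi' : i ∈ Φ.weights.support := by simpa using hi
    simp only [N, dif_pos hi']
    rw [hG]
    exact subset_convexHull_self (hs ⟨i, hi'⟩ (Set.mem_univ _))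

lemma finGen_iUnion_mixes {I : Type u} {X : Type v} (k : I → CSet X) (S : CSet I) :
    ∃ F : Set (Dist X), F.Finite ∧ ⋃ Φ ∈ S.carrier, mixes k Φ = cc F := by
  obtain ⟨B, hB, hS⟩ := S.finGen
  choose F hF hFe using finGen_mixes k
  refine ⟨⋃ Φ ∈ B, F Φ, hB.biUnion fun Φ _ => hF Φ, Set.Subset.antisymm ?_ ?_⟩
  · intro ψ hψ
    simp only [Set.mem_iUnion, exists_prop] at hψ
    obtain ⟨Φ, hΦ, φ, hφ, rfl⟩ := hψ
    choose d hd using fun i => (k i).nonempty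
    classical
    let φ' : I → Dist X := fun i => if Φ.weights i ≠ 0 then φ i else d i
    have hφ' : ∀ i, φ' i ∈ (k i).carrier := by
      intro i
      by_cases h : Φ.weights i = 0
      · simpa [φ', h] using hd i
      · simpa [φ', h] using hφ i h
    have e : mix Φ φ = mix Φ φ' :=
      Convexity.iConvexComb_congr fun i hi => by simp [φ', hi]
    rw [e]
    have haff : IsAffineMap ℝ (fun Φ : Dist I => mix Φ φ') := by
      constructor
      intro w
      rw [sConvexComb_map, ← Convexity.iConvexComb_id]
      exact (mix_mix w id φ').symm
    have hsub : B ⊆ (fun Φ : Dist I => mix Φ φ') ⁻¹' cc (⋃ Φ ∈ B, F Φ) := by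
      intro Ψ hΨ
      have h1 : mix Ψ φ' ∈ cc (F Ψ) := by
        rw [← hFe]; exact ⟨φ', fun i _ => hφ' i, rfl⟩
      exact Convexity.convexHull_mono (Set.subset_biUnion_of_mem hΨ) h1
    exact Convexity.convexHull_min hsub (IsConvexSet.convexHull.preimage haff)
      (Set.mem_of_eq_of_mem rfl (hS.subset hΦ))
  · refine Convexity.convexHull_min ?_ (convex_mixes k _ S.convex)
    refine Set.iUnion₂_subset fun Φ hΦ => ?_
    have h1 : F Φ ⊆ mixes k Φ := by rw [hFe]; exact subset_convexHull_self
    refine h1.trans (Set.subset_biUnion_of_mem (u := fun Φ => mixes k Φ) ?_)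
    rw [hS]; exact subset_convexHull_self hΦ

lemma wms_eq_mixes {X : Type u} (Φ : Dist (CSet X)) : wms Φ = mixes id Φ := rfl

lemma mixes_nonempty {I : Type u} {X : Type v} (k : I → CSet X) (Φ : Dist I) :
    (mixes k Φ).Nonempty := by
  choose d hd using fun i => (k i).nonempty
  exact ⟨_, d, fun i _ => hd i, rfl⟩

/-- Multiplication for `CSet`: the union of the weighted Minkowski sums. -/
def CSet.join {X : Type u} (S : CSet (CSet X)) : CSet X where
  carrier := ⋃ Φ ∈ S.carrier, wms Φ
  nonempty := by
    obtain ⟨Φ, hΦ⟩ := S.nonempty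
    obtain ⟨ψ, hψ⟩ := mixes_nonempty id Φ
    exact ⟨ψ, Set.mem_biUnion hΦ hψ⟩
  convex := convex_mixes id _ S.convex
  finGen := finGen_iUnion_mixes id S

/-! ## Convex sets of subdistributions

A subdistribution on `X` is a distribution on `Option X`; the extra point `none` is `⋆`. -/

/-- The convex set `{δ_⋆}`. -/
def starSet (X : Type u) : CSet (Option X) where
  carrier := {dirac none}
  nonempty := Set.singleton_nonempty _
  convex := IsConvexSet.singleton
  finGen := ⟨{dirac none}, Set.finite_singleton _, by simp⟩

/-- Replaces the outer `⋆` by `{δ_⋆}`. -/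
def collapse {X : Type u} : Option (CSet (Option X)) → CSet (Option X)
  | none => starSet X
  | some U => U

/-- Multiplication of the monad of non-empty finitely generated convex sets of subdistributions. -/
def joinPlus {X : Type u} (S : CSet (Option (CSet (Option X)))) : CSet (Option X) :=
  (S.map collapse).join

/-- A convex set of subdistributions is `⊥`-closed if it is closed under lowering weights on `X`. -/
def IsBotClosed {X : Type u} (S : CSet (Option X)) : Prop :=
  ∀ φ ∈ S.carrier,
    {ψ : Dist (Option X) | ∀ x : X, ψ.weights (some x) ≤ φ.weights (some x)} ⊆ S.carrier

/-- Non-empty finitely generated `⊥`-closed convex sets of subdistributions on `X`. -/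
structure CDown (X : Type u) : Type u where
  val : CSet (Option X)
  isBotClosed : IsBotClosed val

/-! ### Auxiliary facts: the functor, the unit and the multiplication are well defined -/

lemma CSet.ext_mem {X : Type u} {S T : CSet X} (h : ∀ φ, φ ∈ S.carrier ↔ φ ∈ T.carrier) : S = T :=
  CSet.ext (Set.ext h)

/-- The distribution `r x + (1 - r) ⋆`. -/
def partialDirac {X : Type u} (r : unitInterval) (x : X) : Dist (Option X) :=
  StdSimplex.duple (some x) none r.2.1 (sub_nonneg.2 r.2.2) (add_sub_cancel _ _)

/-- Multiplies the weight at each `x : X` by `r x`. -/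
def lower {X : Type u} (r : X → unitInterval) : Option X → Dist (Option X)
  | none => dirac none
  | some x => partialDirac (r x) x

lemma dist_option_ext {X : Type u} {φ ψ : Dist (Option X)}
    (h : ∀ x : X, φ.weights (some x) = ψ.weights (some x)) : φ = ψ := by
  have key : ∀ χ : Dist (Option X),
      χ.weights none + χ.weights.some.sum (fun _ r => r) = 1 := by
    intro χ
    have := χ.total
    rwa [Finsupp.sum_option_index _ _ (by simp) (by simp)] at this
  have hs : φ.weights.some = ψ.weights.some := by
    ext x; simpa using h x
  ext o
  cases o with
  | none =>
    have h1 := key φ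
    have h2 := key ψ
    rw [hs] at h1
    linarith
  | some x => exact h x

lemma lower_weights {X : Type u} (r : X → unitInterval) (φ : Dist (Option X)) (x : X) :
    (mix φ (lower r)).weights (some x) = r x * φ.weights (some x) := by
  classical
  rw [mix_weights, Finsupp.sum_eq_single (some x)]
  · simp [lower, partialDirac, mul_comm]
  · intro o _ ho
    cases o with
    | none => simp [lower]
    | some y =>
      have : y ≠ x := by rintro rfl; exact ho rfl
      simp [lower, partialDirac, this]
  · simp

lemma IsBotClosed.lower_mem {X : Type u} {S : CSet (Option X)} (hS : IsBotClosed S)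
    {φ : Dist (Option X)} (hφ : φ ∈ S.carrier) (r : X → unitInterval) :
    mix φ (lower r) ∈ S.carrier := by
  refine hS φ hφ fun x => ?_
  rw [lower_weights]
  exact mul_le_of_le_one_left (φ.nonneg _) (r x).2.2

lemma exists_lower {X : Type u} {φ ψ : Dist (Option X)}
    (h : ∀ x : X, ψ.weights (some x) ≤ φ.weights (some x)) :
    ∃ r : X → unitInterval, ψ = mix φ (lower r) := by
  refine ⟨fun x => ⟨ψ.weights (some x) / φ.weights (some x),
    div_nonneg (ψ.nonneg _) (φ.nonneg _), div_le_one_of_le₀ (h x) (φ.nonneg _)⟩, ?_⟩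
  refine dist_option_ext fun x => ?_
  rw [lower_weights]
  by_cases h0 : φ.weights (some x) = 0
  · have := h x
    rw [h0] at this
    simp [h0, le_antisymm this (ψ.nonneg _)]
  · simp [h0]

lemma isBotClosed_of_lower {X : Type u} {S : CSet (Option X)}
    (h : ∀ φ ∈ S.carrier, ∀ r : X → unitInterval, mix φ (lower r) ∈ S.carrier) :
    IsBotClosed S := by
  intro φ hφ ψ hψ
  obtain ⟨r, rfl⟩ := exists_lower hψ
  exact h φ hφ r

lemma IsBotClosed.map {X : Type u} {Y : Type v} {S : CSet (Option X)} (hS : IsBotClosed S)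
    (f : X → Y) : IsBotClosed (S.map (Option.map f)) := by
  apply isBotClosed_of_lower
  rintro _ ⟨φ, hφ, rfl⟩ r
  refine ⟨_, hS.lower_mem hφ (fun x => r (f x)), ?_⟩
  simp only [mix, Convexity.map_iConvexComb, Convexity.iConvexComb_map]
  congr 1
  funext o
  cases o <;> simp [lower, partialDirac]

/-- The functor action: the restriction of `C(f + 1)`. -/
def CDown.map {X : Type u} {Y : Type v} (f : X → Y) (S : CDown X) : CDown Y :=
  ⟨S.1.map (Option.map f), S.2.map f⟩

lemma mem_cc_pair {X : Type u} (x : X) (φ : Dist (Option X)) :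
    φ ∈ cc {dirac (some x), dirac none} ↔ ∃ r : unitInterval, φ = partialDirac r x := by
  constructor
  · intro h
    have haff : IsConvexSet ℝ {φ : Dist (Option X) | ∃ r : unitInterval, φ = partialDirac r x} := by
      refine IsConvexSet.of_convexCombPair_mem ?_
      rintro a b ha hb hab _ ⟨r, rfl⟩ _ ⟨s, rfl⟩
      refine ⟨⟨a * r + b * s, add_nonneg (mul_nonneg ha r.2.1) (mul_nonneg hb s.2.1), ?_⟩, ?_⟩
      · nlinarith [r.2.2, s.2.2]
      · classical
        refine dist_option_ext fun y => ?_
        by_cases h : x = y <;> simp [partialDirac, h]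
    refine Convexity.convexHull_min ?_ haff h
    rintro _ (rfl | rfl)
    · exact ⟨1, dist_option_ext fun y => by simp [partialDirac]⟩
    · exact ⟨0, dist_option_ext fun y => by simp [partialDirac]⟩
  · rintro ⟨r, rfl⟩
    have := (IsConvexSet.convexHull (R := ℝ)
      (s := {dirac (some x), (dirac none : Dist (Option X))})).convexCombPair_mem
      (subset_convexHull_self (Set.mem_insert _ _))
      (subset_convexHull_self (Set.mem_insert_of_mem _ rfl)) r.2.1 (sub_nonneg.2 r.2.2)
      (add_sub_cancel _ _)
    convert this using 1
    exact dist_option_ext fun y => by simp [partialDirac]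

/-- The unit: `x` is sent to `cc {δ_x, δ_⋆} = {p x + (1 - p) ⋆ | p ∈ [0,1]}`. -/
def CDown.unit {X : Type u} (x : X) : CDown X :=
  ⟨CSet.ofFinite {dirac (some x), dirac none} (Set.toFinite _) ⟨_, Set.mem_insert _ _⟩, by
    apply isBotClosed_of_lower
    intro φ hφ r
    change _ ∈ cc _
    obtain ⟨s, rfl⟩ := (mem_cc_pair x φ).1 hφ
    refine (mem_cc_pair x _).2 ⟨r x * s, dist_option_ext fun y => ?_⟩
    rw [lower_weights]
    by_cases h : x = y
    · subst h; simp [partialDirac]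
    · simp [partialDirac, h]⟩

/-- The convex set associated with a point of `CDown X + 1`. -/
def CDown.toCSet {X : Type u} : Option (CDown X) → CSet (Option X) :=
  fun o => collapse (o.map CDown.val)

lemma mem_join_map {I : Type u} {X : Type u} (k : I → CSet X) (S : CSet I) (ψ : Dist X) :
    ψ ∈ (S.map k).join.carrier ↔ ∃ Φ ∈ S.carrier, ψ ∈ mixes k Φ := by
  simp [CSet.join, CSet.map, wms_map]

lemma joinPlus_map {X : Type u} (S : CSet (Option (CDown X))) :
    joinPlus (S.map (Option.map CDown.val)) = (S.map CDown.toCSet).join := by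
  unfold joinPlus
  congr 1
  refine CSet.ext ?_
  simp only [CSet.map, Set.image_image, StdSimplex.map_map]
  rfl

lemma lower_mem_toCSet {X : Type u} (o : Option (CDown X)) {φ : Dist (Option X)}
    (hφ : φ ∈ (CDown.toCSet o).carrier) (r : X → unitInterval) :
    mix φ (lower r) ∈ (CDown.toCSet o).carrier := by
  cases o with
  | none =>
    change φ = _ at hφ
    subst hφ
    change _ = _
    simp [mix, lower]
  | some U => exact U.2.lower_mem hφ r

lemma isBotClosed_join {X : Type u} (S : CSet (Option (CDown X))) :
    IsBotClosed (joinPlus (S.map (Option.map CDown.val))) := by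
  rw [joinPlus_map]
  apply isBotClosed_of_lower
  intro ψ hψ r
  rw [mem_join_map] at hψ ⊢
  obtain ⟨Φ, hΦ, φ, hφ, rfl⟩ := hψ
  refine ⟨Φ, hΦ, fun o => mix (φ o) (lower r), fun o ho => lower_mem_toCSet o (hφ o ho) r, ?_⟩
  rw [mix_mix]

/-- The multiplication: the restriction of `joinPlus` to `⊥`-closed sets. -/
def CDown.join {X : Type u} (S : CDown (CDown X)) : CDown X :=
  ⟨joinPlus (S.1.map (Option.map CDown.val)), isBotClosed_join S.1⟩

/-! ### Auxiliary facts: the monad laws -/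

lemma CDown.mem_join {X : Type u} (S : CDown (CDown X)) (ψ : Dist (Option X)) :
    ψ ∈ S.join.1.carrier ↔ ∃ Φ ∈ S.1.carrier, ψ ∈ mixes CDown.toCSet Φ := by
  change ψ ∈ (joinPlus (S.1.map (Option.map CDown.val))).carrier ↔ _
  rw [joinPlus_map, mem_join_map]

lemma CDown.ext {X : Type u} {S T : CDown X} (h : S.1 = T.1) : S = T := by
  cases S
  cases T
  cases h
  rfl

lemma CDown.ext_mem {X : Type u} {S T : CDown X}
    (h : ∀ φ, φ ∈ S.1.carrier ↔ φ ∈ T.1.carrier) : S = T :=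
  CDown.ext (CSet.ext_mem h)

lemma CDown.map_id {X : Type u} (S : CDown X) : S.map id = S := by
  refine CDown.ext_mem fun φ => ?_
  simp [CDown.map, CSet.map]

lemma CDown.map_comp {X Y Z : Type u} (f : X → Y) (g : Y → Z) (S : CDown X) :
    S.map (g ∘ f) = (S.map f).map g := by
  refine CDown.ext_mem fun φ => ?_
  simp [CDown.map, CSet.map, StdSimplex.map_map, Function.comp_def]

lemma CDown.map_unit {X Y : Type u} (f : X → Y) (x : X) :
    (CDown.unit x).map f = CDown.unit (f x) := by
  refine CDown.ext (CSet.ext ?_)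
  simp only [CDown.map, CSet.map, CDown.unit, CSet.ofFinite]
  rw [(StdSimplex.isAffineMap_map ℝ _).image_convexHull, Set.image_pair]
  simp

lemma map_mem_toCSet {X Y : Type u} (f : X → Y) (o : Option (CDown X)) :
    (CDown.toCSet (o.map (CDown.map f))).carrier =
      (StdSimplex.map (Option.map f)) '' (CDown.toCSet o).carrier := by
  cases o with
  | none =>
    change {dirac none} = StdSimplex.map (Option.map f) '' {dirac none}
    simp
  | some U => rfl

/-- The multiplication applied after a push-forward along `k`. -/
lemma mixes_map {I J : Type u} {X : Type v} (k : J → CSet X) (f : I → J) (Φ : Dist I) :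
    mixes k (Φ.map f) = mixes (fun i => k (f i)) Φ := by
  ext ψ
  constructor
  · rintro ⟨φ, h, rfl⟩
    refine ⟨fun i => φ (f i), fun i hi => h _ ?_, by simp [mix]⟩
    rw [map_eq_mix]
    exact mix_weights_ne _ _ i _ hi (by simp)
  · rintro ⟨φ, h, rfl⟩
    exact exists_merge Φ f φ (fun j => (k j).carrier) (fun j => (k j).convex) h

lemma CDown.map_join {X Y : Type u} (f : X → Y) (S : CDown (CDown X)) :
    S.join.map f = (S.map (CDown.map f)).join := by
  refine CDown.ext_mem fun ψ => ?_
  rw [CDown.mem_join]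
  constructor
  · rintro ⟨χ, hχ, rfl⟩
    obtain ⟨Φ, hΦ, φ, hφ, rfl⟩ := (CDown.mem_join _ _).1 hχ
    refine ⟨_, ⟨Φ, hΦ, rfl⟩, ?_⟩
    rw [mixes_map]
    refine ⟨fun o => (φ o).map (Option.map f), fun o ho => ?_, ?_⟩
    · rw [map_mem_toCSet]; exact ⟨_, hφ o ho, rfl⟩
    · simp only [mix, Convexity.map_iConvexComb]; rfl
  · rintro ⟨_, ⟨Φ, hΦ, rfl⟩, hψ⟩
    rw [mixes_map] at hψ
    obtain ⟨φ, hφ, rfl⟩ := hψ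
    simp only [map_mem_toCSet] at hφ
    have : Nonempty (Dist (Option X)) := ⟨dirac none⟩
    choose! χ hχ hχe using hφ
    refine ⟨mix Φ χ, (CDown.mem_join _ _).2 ⟨Φ, hΦ, χ, hχ, rfl⟩, ?_⟩
    simp only [mix, Convexity.map_iConvexComb]
    exact Convexity.iConvexComb_congr fun o ho => hχe o ho

lemma CDown.join_unit {X : Type u} (S : CDown X) : (CDown.unit S).join = S := by
  refine CDown.ext_mem fun ψ => ?_
  rw [CDown.mem_join]
  constructor
  · rintro ⟨Φ, hΦ, φ, hφ, rfl⟩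
    obtain ⟨r, rfl⟩ := (mem_cc_pair S Φ).1 hΦ
    obtain ⟨d, hd⟩ := S.1.nonempty
    classical
    let χ : Dist (Option X) := if (r : ℝ) = 0 then d else φ (some S)
    have hχ : χ ∈ S.1.carrier := by
      by_cases h : (r : ℝ) = 0
      · simpa [χ, h] using hd
      · have := hφ (some S) (by simp [partialDirac, h])
        simp only [χ, h, if_false]
        exact this
    have e : mix (partialDirac r S) φ = mix χ (lower fun _ => r) := by
      refine dist_option_ext fun x => ?_
      rw [lower_weights, mix_weights]
      have hn : (1 - (r : ℝ)) * (φ none).weights (some x) = 0 := by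
        by_cases h : 1 - (r : ℝ) = 0
        · simp [h]
        · have := hφ none (by simp [partialDirac, h])
          change φ none = _ at this
          simp [this]
      rw [partialDirac, StdSimplex.weights_duple,
        Finsupp.sum_add_index (by simp) (by intros; ring)]
      rw [Finsupp.sum_single_index (by simp), Finsupp.sum_single_index (by simp), hn, add_zero]
      by_cases h : (r : ℝ) = 0
      · simp [h]
      · simp [χ, h]
    rw [e]
    exact S.2.lower_mem hχ _
  · intro h
    refine ⟨dirac (some S), subset_convexHull_self (Set.mem_insert _ _), fun _ => ψ, ?_, by simp⟩
    intro o ho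
    have : o = some S := by
      by_contra hne
      exact ho (by classical simp [Ne.symm hne])
    subst this
    exact h

lemma CDown.join_map_unit {X : Type u} (S : CDown X) : (S.map CDown.unit).join = S := by
  refine CDown.ext_mem fun ψ => ?_
  rw [CDown.mem_join]
  constructor
  · rintro ⟨_, ⟨Φ, hΦ, rfl⟩, hψ⟩
    rw [mixes_map] at hψ
    obtain ⟨φ, hφ, rfl⟩ := hψ
    have : ∀ x : X, ∃ r : unitInterval, Φ.weights (some x) ≠ 0 → φ (some x) = partialDirac r x := by
      intro x
      by_cases h : Φ.weights (some x) = 0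
      · exact ⟨0, fun h' => absurd h h'⟩
      · obtain ⟨r, hr⟩ := (mem_cc_pair x _).1 (hφ (some x) h)
        exact ⟨r, fun _ => hr⟩
    choose r hr using this
    have e : mix Φ φ = mix Φ (lower r) := by
      refine Convexity.iConvexComb_congr fun o ho => ?_
      cases o with
      | none => exact hφ none ho
      | some x => exact hr x ho
    rw [e]
    exact S.2.lower_mem hΦ r
  · intro h
    refine ⟨_, ⟨ψ, h, rfl⟩, ?_⟩
    rw [mixes_map]
    refine ⟨dirac, fun o _ => ?_, (mix_dirac ψ).symm⟩
    cases o with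
    | none => exact rfl
    | some x => exact subset_convexHull_self (Set.mem_insert _ _)

lemma CDown.join_join {X : Type u} (S : CDown (CDown (CDown X))) :
    (S.map CDown.join).join = S.join.join := by
  refine CDown.ext_mem fun ψ => ?_
  rw [CDown.mem_join, CDown.mem_join]
  have hmem : ∀ (o : Option (CDown (CDown X))) (χ : Dist (Option X)),
      χ ∈ (CDown.toCSet (o.map CDown.join)).carrier ↔
        ∃ Φ ∈ (CDown.toCSet o).carrier, χ ∈ mixes CDown.toCSet Φ := by
    intro o χ
    cases o with
    | none =>
      constructor
      · intro h
        change χ = _ at h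
        subst h
        exact ⟨dirac none, rfl, fun _ => dirac none, fun o ho => by
          cases o with
          | none => exact rfl
          | some U => simp at ho, by simp⟩
      · rintro ⟨Φ, hΦ, φ, hφ, rfl⟩
        change Φ = _ at hΦ
        subst hΦ
        have := hφ none (by simp)
        change φ none = _ at this
        change _ = _
        simp [mix, this]
    | some U => exact CDown.mem_join U χ
  constructor
  · rintro ⟨_, ⟨Θ, hΘ, rfl⟩, hψ⟩
    rw [mixes_map] at hψ
    obtain ⟨φ, hφ, rfl⟩ := hψ
    simp only [hmem] at hφ
    have : Nonempty (Dist (Option X)) := ⟨dirac none⟩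
    have : Nonempty (Dist (Option (CDown X))) := ⟨dirac none⟩
    choose! g hg χ hχ hχe using hφ
    obtain ⟨φ', h1, h2⟩ := exists_merge₂ Θ g χ (fun o => (CDown.toCSet o).carrier)
      (fun o => (CDown.toCSet o).convex) (fun j i hj hi => hχ j hj i hi)
    refine ⟨mix Θ g, (CDown.mem_join _ _).2 ⟨Θ, hΘ, g, hg, rfl⟩, φ', h1, ?_⟩
    rw [← h2]
    exact Convexity.iConvexComb_congr hχe
  · rintro ⟨Φ, hΦ, φ, hφ, rfl⟩
    obtain ⟨Θ, hΘ, g, hg, rfl⟩ := (CDown.mem_join _ _).1 hΦ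
    refine ⟨_, ⟨Θ, hΘ, rfl⟩, ?_⟩
    rw [mixes_map]
    refine ⟨fun o => mix (g o) φ, fun o ho => ?_, ?_⟩
    · rw [hmem]
      exact ⟨g o, hg o ho, φ, fun i hi => hφ i (mix_weights_ne _ _ o i ho hi), rfl⟩
    · rw [mix_mix]

/-- The monad on the category of sets of non-empty finitely generated `⊥`-closed convex sets of
subdistributions. -/
def cDownMonad : Monad (Type u) where
  obj X := CDown X
  map f := ↾(CDown.map f)
  map_id X := by ext S; exact CDown.map_id S
  map_comp f g := by ext S; exact CDown.map_comp f g S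
  η := { app := fun _ => ↾CDown.unit
         naturality := fun _ _ f => by ext x; exact (CDown.map_unit f x).symm }
  μ := { app := fun _ => ↾CDown.join
         naturality := fun _ _ f => by ext S; exact (CDown.map_join f S).symm }
  assoc X := by ext S; exact CDown.join_join S
  left_unit X := by ext S; exact CDown.join_unit S
  right_unit X := by ext S; exact CDown.join_map_unit S

/-! ## The theory of convex semilattices with bottom -/

/-- Indices `p ∈ (0,1)` of the operations `+_p`. -/
abbrev Prob : Type := Set.Ioo (0 : ℝ) 1

/-- `1 - p`. -/
def Prob.compl (p : Prob) : Prob := ⟨1 - p.1, sub_pos.2 p.2.2, sub_lt_self _ p.2.1⟩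

/-- `p q`. -/
def Prob.mul (p q : Prob) : Prob :=
  ⟨p.1 * q.1, mul_pos p.2.1 q.2.1, mul_lt_one_of_nonneg_of_lt_one_left p.2.1.le p.2.2 q.2.2.le⟩

/-- `p (1 - q) / (1 - p q)`. -/
def Prob.assoc (p q : Prob) : Prob :=
  ⟨p.1 * (1 - q.1) / (1 - p.1 * q.1),
    div_pos (mul_pos p.2.1 (sub_pos.2 q.2.2)) (sub_pos.2 (p.mul q).2.2),
    (div_lt_one (sub_pos.2 (p.mul q).2.2)).2 (by
      have := p.2.2
      change p.1 * (1 - q.1) < 1 - p.1 * q.1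
      nlinarith)⟩

/-- Convex semilattices with bottom. -/
structure ConvSemilatBot : Type (u + 1) where
  carrier : Type u
  /-- `x ⊕ y` -/
  oplus : carrier → carrier → carrier
  /-- `x +_p y` -/
  pplus : Prob → carrier → carrier → carrier
  /-- `⋆` -/
  star : carrier
  oplus_assoc : ∀ x y z, oplus x (oplus y z) = oplus (oplus x y) z
  oplus_comm : ∀ x y, oplus x y = oplus y x
  oplus_idem : ∀ x, oplus x x = x
  pplus_assoc : ∀ p q x y z,
    pplus p (pplus q x y) z = pplus (p.mul q) x (pplus (p.assoc q) y z)
  pplus_comm : ∀ p x y, pplus p x y = pplus p.compl y x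
  pplus_idem : ∀ p x, pplus p x x = x
  pplus_oplus : ∀ p x y z, pplus p x (oplus y z) = oplus (pplus p x y) (pplus p x z)
  oplus_star : ∀ x, oplus x star = x

namespace ConvSemilatBot

/-- Homomorphisms: functions that preserve all the operations. -/
@[ext]
structure Hom (A B : ConvSemilatBot.{u}) : Type u where
  toFun : A.carrier → B.carrier
  map_oplus : ∀ x y, toFun (A.oplus x y) = B.oplus (toFun x) (toFun y)
  map_pplus : ∀ p x y, toFun (A.pplus p x y) = B.pplus p (toFun x) (toFun y)
  map_star : toFun A.star = B.star

instance : Category.{u} ConvSemilatBot.{u} where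
  Hom := Hom
  id A := ⟨id, fun _ _ => rfl, fun _ _ _ => rfl, rfl⟩
  comp f g := ⟨g.toFun ∘ f.toFun, fun x y => by simp [f.map_oplus, g.map_oplus],
    fun p x y => by simp [f.map_pplus, g.map_pplus], by simp [f.map_star, g.map_star]⟩

/-- The underlying set functor. -/
def forget : ConvSemilatBot.{u} ⥤ Type u where
  obj A := A.carrier
  map f := ↾f.toFun

end ConvSemilatBot

end ConvexSets

end

/-!
The reason is that `CDown X` is the free convex semilattice with bottom on `X`.

Convex union, weighted Minkowski sum and `{δ_⋆}` make `CDown X` a convex semilattice with bottom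
`CDown.free X`, and both push-forward and the multiplication of the monad are homomorphisms
(`CDown.mapHom`, `CDown.joinHom`).

*Uniqueness of extensions* (`CDown.hom_congr`). The units generate `CDown X`
(`CDown.free_induction`): mixtures of units and of `{δ_⋆}` give the sets `↓φ` of the
subdistributions below a given `φ`, and a set generated by `φ₁, …, φₙ` is the join of the `↓φᵢ`.

*Existence of extensions* (`ConvSemilatBot.structHom`). In a convex semilattice with bottom `B`,
every subdistribution on `B` has a barycentre, `ConvSemilatBot.eval`. To define it without choosing
an order of summation, `B` is embedded as the points of weight one in the cone
`ConvSemilatBot.Cone B`, which is a module over `ℝ≥0`: associativity and commutativity of the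
sum are the skew associativity and commutativity of `+_p`, and distributivity over scalars is
idempotence. A convex set of subdistributions is sent to the supremum of the barycentres of its elements for the
order `x ≤ y ↔ x ⊕ y = y`. This exists for a finitely generated set, as an upper bound of the
generators bounds their convex closure, and it does not depend on the generators. It commutes with
mixtures because `+_p` distributes over `⊕`, and sends `cc {δ_x, δ_⋆}` to `x` because `x ⊕ ⋆ = x`.

For an Eilenberg–Moore algebra with structure map `a`, the operations on units followed by `a`
satisfy the laws because `a` is a surjection from the free object that preserves the operations
(`ofAlgebra`). Conversely the supremum is an algebra structure (`toAlgebra`). The two constructions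
are mutually inverse and have the same morphisms because in each case two homomorphisms from a
free object are compared on units.
-/

noncomputable section

namespace ConvexSets

open Convexity

/-! ### The free convex semilattice with bottom -/

/-- The mixture `p φ + (1 - p) ψ`. -/
def comb {X : Type u} (p : Prob) (φ ψ : Dist X) : Dist X :=
  convexCombPair p.1 (1 - p.1) p.2.1.le (sub_nonneg.2 p.2.2.le) (add_sub_cancel _ _) φ ψ

lemma comb_weights {X : Type u} (p : Prob) (φ ψ : Dist X) (x : X) :
    (comb p φ ψ).weights x = p.1 * φ.weights x + (1 - p.1) * ψ.weights x := by
  simp [comb]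

lemma comb_comm {X : Type u} (p : Prob) (φ ψ : Dist X) : comb p φ ψ = comb p.compl ψ φ := by
  ext x
  simp only [comb_weights, Prob.compl]
  ring

lemma comb_self {X : Type u} (p : Prob) (φ : Dist X) : comb p φ φ = φ := by
  ext x
  simp only [comb_weights]
  ring

lemma comb_assoc {X : Type u} (p q : Prob) (φ ψ χ : Dist X) :
    comb p (comb q φ ψ) χ = comb (p.mul q) φ (comb (p.assoc q) ψ χ) := by
  ext x
  have h : 1 - p.1 * q.1 ≠ 0 := (sub_pos.2 (p.mul q).2.2).ne'
  simp only [comb_weights, Prob.mul, Prob.assoc]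
  field_simp
  ring

lemma isAffineMap_comb_right {X : Type u} (p : Prob) (φ : Dist X) :
    IsAffineMap ℝ (comb p φ) :=
  isAffineMap_convexCombPair _ _ _ φ

lemma isAffineMap_comb_left {X : Type u} (p : Prob) (ψ : Dist X) :
    IsAffineMap ℝ (fun φ => comb p φ ψ) := by
  have h : (fun φ => comb p φ ψ) = comb p.compl ψ := funext fun φ => comb_comm p φ ψ
  exact h ▸ isAffineMap_comb_right _ _

lemma isAffineMap_mix {I : Type u} {X : Type u} (φ : I → Dist X) :
    IsAffineMap ℝ (fun Φ : Dist I => mix Φ φ) where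
  map_sConvexComb w := by
    rw [sConvexComb_map, ← Convexity.iConvexComb_id]
    exact (mix_mix w id φ).symm

lemma mix_comb {I : Type u} {X : Type u} (p : Prob) (Φ Ψ : Dist I) (φ : I → Dist X) :
    mix (comb p Φ Ψ) φ = comb p (mix Φ φ) (mix Ψ φ) :=
  (isAffineMap_mix φ).map_convexCombPair _ _ _ Φ Ψ

lemma map_comb {X Y : Type u} (f : X → Y) (p : Prob) (φ ψ : Dist X) :
    (comb p φ ψ).map f = comb p (φ.map f) (ψ.map f) :=
  (StdSimplex.isAffineMap_map ℝ f).map_convexCombPair _ _ _ φ ψ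

lemma _root_.Convexity.IsConvexSet.comb_mem {X : Type u} {S : Set (Dist X)}
    (hS : IsConvexSet ℝ S) (p : Prob) {φ ψ : Dist X} (hφ : φ ∈ S) (hψ : ψ ∈ S) :
    comb p φ ψ ∈ S :=
  hS.convexCombPair_mem hφ hψ _ _ _

/-- Convexity need only be tested on mixtures with weights in the open interval. -/
lemma isConvexSet_of_comb_mem {X : Type u} {S : Set (Dist X)}
    (h : ∀ p, ∀ φ ∈ S, ∀ ψ ∈ S, comb p φ ψ ∈ S) : IsConvexSet ℝ S := by
  refine IsConvexSet.of_convexCombPair_mem fun a b ha hb hab φ hφ ψ hψ => ?_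
  obtain rfl : b = 1 - a := by linarith
  rcases ha.eq_or_lt with rfl | ha'
  · have : convexCombPair (0 : ℝ) (1 - 0) ha hb hab φ ψ = ψ := by ext x; simp
    rwa [this]
  rcases hb.eq_or_lt with hb' | hb'
  · obtain rfl : a = 1 := by linarith
    have : convexCombPair (1 : ℝ) (1 - 1) ha hb hab φ ψ = φ := by ext x; simp
    rwa [this]
  · exact h ⟨a, ha', by linarith⟩ φ hφ ψ hψ

/-- The convex closure of the union. -/
def CSet.oplus {X : Type u} (S T : CSet X) : CSet X where
  carrier := cc (S.carrier ∪ T.carrier)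
  nonempty := convexHull_nonempty.2 S.nonempty.inl
  convex := IsConvexSet.convexHull
  finGen := by
    obtain ⟨F, hF, h⟩ := S.finGen
    obtain ⟨G, hG, h'⟩ := T.finGen
    exact ⟨F ∪ G, hF.union hG, by rw [h, h']; simp⟩

lemma isConvexSet_image2_comb {X : Type u} (p : Prob) {S T : Set (Dist X)}
    (hS : IsConvexSet ℝ S) (hT : IsConvexSet ℝ T) : IsConvexSet ℝ (Set.image2 (comb p) S T) := by
  refine isConvexSet_of_comb_mem fun q => ?_
  rintro _ ⟨φ, hφ, ψ, hψ, rfl⟩ _ ⟨φ', hφ', ψ', hψ', rfl⟩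
  refine ⟨comb q φ φ', hS.comb_mem q hφ hφ', comb q ψ ψ', hT.comb_mem q hψ hψ', ?_⟩
  ext x
  simp only [comb_weights]
  ring

lemma image2_comb_cc {X : Type u} (p : Prob) (F G : Set (Dist X)) :
    Set.image2 (comb p) (cc F) (cc G) = cc (Set.image2 (comb p) F G) := by
  refine Set.Subset.antisymm ?_ (Convexity.convexHull_min
    (Set.image2_subset subset_convexHull_self subset_convexHull_self)
    (isConvexSet_image2_comb p IsConvexSet.convexHull IsConvexSet.convexHull))
  rintro _ ⟨φ, hφ, ψ, hψ, rfl⟩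
  have h : F ⊆ (fun φ => comb p φ ψ) ⁻¹' cc (Set.image2 (comb p) F G) := fun φ hφ => by
    have h' : G ⊆ comb p φ ⁻¹' cc (Set.image2 (comb p) F G) :=
      fun ψ hψ => subset_convexHull_self (Set.mem_image2_of_mem hφ hψ)
    exact Convexity.convexHull_min h'
      (IsConvexSet.convexHull.preimage (isAffineMap_comb_right p φ)) hψ
  exact Convexity.convexHull_min h
    (IsConvexSet.convexHull.preimage (isAffineMap_comb_left p ψ)) hφ

/-- The weighted Minkowski sum `p S + (1 - p) T`. -/
def CSet.pplus {X : Type u} (p : Prob) (S T : CSet X) : CSet X where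
  carrier := Set.image2 (comb p) S.carrier T.carrier
  nonempty := S.nonempty.image2 T.nonempty
  convex := isConvexSet_image2_comb p S.convex T.convex
  finGen := by
    obtain ⟨F, hF, h⟩ := S.finGen
    obtain ⟨G, hG, h'⟩ := T.finGen
    exact ⟨_, hF.image2 (comb p) hG, by rw [h, h', image2_comb_cc]⟩

lemma CDown.dirac_none_mem {X : Type u} (S : CDown X) : dirac none ∈ S.1.carrier := by
  obtain ⟨φ, hφ⟩ := S.1.nonempty
  refine S.2 φ hφ fun x => ?_
  simp

/-- The convex closure of the union of two `⊥`-closed sets. -/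
def CDown.oplus {X : Type u} (S T : CDown X) : CDown X :=
  ⟨S.1.oplus T.1, isBotClosed_of_lower fun φ hφ r => by
    have h : S.1.carrier ∪ T.1.carrier ⊆ (fun φ => mix φ (lower r)) ⁻¹' (S.1.oplus T.1).carrier :=
      fun ψ hψ => subset_convexHull_self (hψ.imp (S.2.lower_mem · r) (T.2.lower_mem · r))
    exact Convexity.convexHull_min h
      ((S.1.oplus T.1).convex.preimage (isAffineMap_mix (lower r))) hφ⟩

/-- The weighted Minkowski sum of two `⊥`-closed sets. -/
def CDown.pplus {X : Type u} (p : Prob) (S T : CDown X) : CDown X :=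
  ⟨S.1.pplus p T.1, isBotClosed_of_lower fun φ hφ r => by
    obtain ⟨φ, hφ, ψ, hψ, rfl⟩ := hφ
    exact ⟨_, S.2.lower_mem hφ r, _, T.2.lower_mem hψ r, (mix_comb ..).symm⟩⟩

/-- The `⊥`-closed set `{δ_⋆}`. -/
def CDown.star (X : Type u) : CDown X :=
  ⟨starSet X, isBotClosed_of_lower fun φ hφ r => by
    change φ = _ at hφ
    subst hφ
    change _ = _
    simp [mix, lower]⟩

lemma CDown.left_subset_oplus {X : Type u} (S T : CDown X) :
    S.1.carrier ⊆ (S.oplus T).1.carrier :=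
  Set.subset_union_left.trans subset_convexHull_self

lemma CDown.right_subset_oplus {X : Type u} (S T : CDown X) :
    T.1.carrier ⊆ (S.oplus T).1.carrier :=
  Set.subset_union_right.trans subset_convexHull_self

lemma CDown.oplus_subset {X : Type u} {S T : CDown X} {C : Set (Dist (Option X))}
    (hC : IsConvexSet ℝ C) (hS : S.1.carrier ⊆ C) (hT : T.1.carrier ⊆ C) :
    (S.oplus T).1.carrier ⊆ C :=
  Convexity.convexHull_min (Set.union_subset hS hT) hC

lemma CDown.pplus_oplus {X : Type u} (p : Prob) (S T U : CDown X) :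
    S.pplus p (T.oplus U) = (S.pplus p T).oplus (S.pplus p U) := by
  refine CDown.ext <| CSet.ext <| Set.Subset.antisymm ?_
    (CDown.oplus_subset (S.pplus p (T.oplus U)).1.convex
      (Set.image2_subset_left (T.left_subset_oplus U))
      (Set.image2_subset_left (T.right_subset_oplus U)))
  rintro _ ⟨φ, hφ, ψ, hψ, rfl⟩
  exact CDown.oplus_subset
    (((S.pplus p T).oplus (S.pplus p U)).1.convex.preimage (isAffineMap_comb_right p φ))
    (fun χ hχ => CDown.left_subset_oplus _ _ (Set.mem_image2_of_mem hφ hχ))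
    (fun χ hχ => CDown.right_subset_oplus _ _ (Set.mem_image2_of_mem hφ hχ)) hψ

/-- The convex semilattice with bottom of `⊥`-closed convex sets of subdistributions on `X`, with
convex union, weighted Minkowski sum and `{δ_⋆}`. -/
abbrev CDown.free (X : Type u) : ConvSemilatBot.{u} where
  carrier := CDown X
  oplus := CDown.oplus
  pplus := CDown.pplus
  star := CDown.star X
  oplus_assoc S T U := CDown.ext <| CSet.ext <| by
    simp [CDown.oplus, CSet.oplus, Set.union_assoc]
  oplus_comm S T := CDown.ext <| CSet.ext <| by
    simp [CDown.oplus, CSet.oplus, Set.union_comm]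
  oplus_idem S := CDown.ext <| CSet.ext <| by
    simpa [CDown.oplus, CSet.oplus] using S.1.convex.convexHull_eq_self
  pplus_assoc p q S T U := CDown.ext_mem fun φ => by
    constructor
    · rintro ⟨_, ⟨φ, hφ, ψ, hψ, rfl⟩, χ, hχ, rfl⟩
      exact ⟨φ, hφ, _, ⟨ψ, hψ, χ, hχ, rfl⟩, (comb_assoc ..).symm⟩
    · rintro ⟨φ, hφ, _, ⟨ψ, hψ, χ, hχ, rfl⟩, rfl⟩
      exact ⟨_, ⟨φ, hφ, ψ, hψ, rfl⟩, χ, hχ, comb_assoc ..⟩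
  pplus_comm p S T := CDown.ext <| CSet.ext <| by
    simp only [CDown.pplus, CSet.pplus]
    rw [Set.image2_swap]
    congr 1
    funext φ ψ
    exact comb_comm p ψ φ
  pplus_idem p S := CDown.ext_mem fun φ => by
    constructor
    · rintro ⟨φ, hφ, ψ, hψ, rfl⟩
      exact S.1.convex.comb_mem p hφ hψ
    · exact fun hφ => ⟨φ, hφ, φ, hφ, comb_self p φ⟩
  pplus_oplus := CDown.pplus_oplus
  oplus_star S := CDown.ext <| CSet.ext <| by
    have h : S.1.carrier ∪ (starSet X).carrier = S.1.carrier :=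
      Set.union_eq_left.2 (Set.singleton_subset_iff.2 S.dirac_none_mem)
    change cc (S.1.carrier ∪ (starSet X).carrier) = _
    rw [h]
    exact S.1.convex.convexHull_eq_self

/-- Push-forward is a homomorphism. -/
def CDown.mapHom {X Y : Type u} (f : X → Y) :
    ConvSemilatBot.Hom (CDown.free X) (CDown.free Y) where
  toFun := CDown.map f
  map_oplus S T := CDown.ext <| CSet.ext <| by
    simp only [CDown.map, CSet.map, CDown.oplus, CSet.oplus]
    rw [(StdSimplex.isAffineMap_map ℝ _).image_convexHull, Set.image_union]
  map_pplus p S T := CDown.ext <| CSet.ext <|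
    Set.image_image2_distrib fun φ ψ => map_comb _ p φ ψ
  map_star := CDown.ext <| CSet.ext <| by
    simp [CDown.map, CSet.map, CDown.star, starSet]

/-- The values of a selection outside of the support of the mixing distribution are immaterial, so
they can be taken in the given sets too. -/
lemma exists_selection {I X : Type u} {k : I → CSet X} {Φ : Dist I} {ψ : Dist X}
    (h : ψ ∈ mixes k Φ) : ∃ φ : I → Dist X, (∀ i, φ i ∈ (k i).carrier) ∧ ψ = mix Φ φ := by
  obtain ⟨φ, hφ, rfl⟩ := h
  classical
  choose d hd using fun i => (k i).nonempty
  refine ⟨fun i => if Φ.weights i = 0 then d i else φ i, fun i => ?_, ?_⟩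
  · by_cases h : Φ.weights i = 0
    · simpa [h] using hd i
    · simpa [h] using hφ i h
  · exact Convexity.iConvexComb_congr fun i hi => by simp [hi]

lemma mixes_comb {I X : Type u} (k : I → CSet X) (p : Prob) (Φ Ψ : Dist I) :
    mixes k (comb p Φ Ψ) = Set.image2 (comb p) (mixes k Φ) (mixes k Ψ) := by
  ext χ
  constructor
  · intro h
    obtain ⟨φ, hφ, rfl⟩ := exists_selection h
    exact ⟨_, ⟨φ, fun i _ => hφ i, rfl⟩, _, ⟨φ, fun i _ => hφ i, rfl⟩, (mix_comb ..).symm⟩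
  · rintro ⟨_, ⟨φ, hφ, rfl⟩, _, ⟨ψ, hψ, rfl⟩, rfl⟩
    have hp := add_sub_cancel p.1 1
    -- the two selections are averaged into one that serves the mixture of `Φ` and `Ψ`
    obtain ⟨φ', h1, h2⟩ := exists_merge₂
      (StdSimplex.duple (ULift.up (0 : Fin 2)) (ULift.up 1) p.2.1.le
        (sub_nonneg.2 p.2.2.le) hp)
      (fun j => ![Φ, Ψ] j.down) (fun j => ![φ, ψ] j.down)
      (fun i => (k i).carrier) (fun i => (k i).convex) (by
        rintro ⟨j⟩ i _ hi
        fin_cases j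
        · exact hφ i hi
        · exact hψ i hi)
    rw [mix_duple] at h1
    rw [mix_duple, mix_duple] at h2
    exact ⟨φ', h1, h2⟩

/-- The multiplication is a homomorphism. -/
def CDown.joinHom (X : Type u) :
    ConvSemilatBot.Hom (CDown.free (CDown X)) (CDown.free X) where
  toFun := CDown.join
  map_oplus S T := CDown.ext <| CSet.ext <| by
    refine Set.Subset.antisymm (fun ψ hψ => ?_) ?_
    · obtain ⟨Φ, hΦ, hψ⟩ := (CDown.mem_join _ _).1 hψ
      obtain ⟨φ, hφ, rfl⟩ := exists_selection hψ
      exact CDown.oplus_subset ((S.join.oplus T.join).1.convex.preimage (isAffineMap_mix φ))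
        (fun Ψ hΨ => CDown.left_subset_oplus _ _
          ((CDown.mem_join _ _).2 ⟨Ψ, hΨ, φ, fun i _ => hφ i, rfl⟩))
        (fun Ψ hΨ => CDown.right_subset_oplus _ _
          ((CDown.mem_join _ _).2 ⟨Ψ, hΨ, φ, fun i _ => hφ i, rfl⟩)) hΦ
    · refine CDown.oplus_subset (CDown.join _).1.convex (fun ψ hψ => ?_) (fun ψ hψ => ?_)
      all_goals
        obtain ⟨Φ, hΦ, hψ⟩ := (CDown.mem_join _ _).1 hψ
        refine (CDown.mem_join _ _).2 ⟨Φ, ?_, hψ⟩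
      exacts [S.left_subset_oplus T hΦ, S.right_subset_oplus T hΦ]
  map_pplus p S T := CDown.ext_mem fun ψ => by
    rw [CDown.mem_join]
    constructor
    · rintro ⟨_, ⟨Φ, hΦ, Ψ, hΨ, rfl⟩, hψ⟩
      rw [mixes_comb] at hψ
      obtain ⟨φ, hφ, χ, hχ, rfl⟩ := hψ
      exact ⟨φ, (CDown.mem_join _ _).2 ⟨Φ, hΦ, hφ⟩, χ, (CDown.mem_join _ _).2 ⟨Ψ, hΨ, hχ⟩, rfl⟩
    · rintro ⟨φ, hφ, χ, hχ, rfl⟩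
      obtain ⟨Φ, hΦ, hφ⟩ := (CDown.mem_join _ _).1 hφ
      obtain ⟨Ψ, hΨ, hχ⟩ := (CDown.mem_join _ _).1 hχ
      refine ⟨_, ⟨Φ, hΦ, Ψ, hΨ, rfl⟩, ?_⟩
      rw [mixes_comb]
      exact ⟨φ, hφ, χ, hχ, rfl⟩
  map_star := CDown.ext_mem fun ψ => by
    rw [CDown.mem_join]
    constructor
    · rintro ⟨Φ, hΦ, φ, hφ, rfl⟩
      change Φ = _ at hΦ
      subst hΦ
      have : φ none = _ := hφ none (by simp)
      change _ = _
      simp [mix, this]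
    · intro h
      change ψ = _ at h
      subst h
      refine ⟨dirac none, rfl, fun _ => dirac none, fun o ho => ?_, by simp⟩
      cases o with
      | none => exact rfl
      | some U => simp at ho

/-! ### Generation by units -/

/-- Every convex set of subdistributions is built from units by the operations. -/
lemma CDown.free_induction {X : Type u} {P : CDown X → Prop}
    (unit : ∀ x, P (CDown.unit x)) (star : P (CDown.star X))
    (oplus : ∀ S T, P S → P T → P (S.oplus T))
    (pplus : ∀ p S T, P S → P T → P (S.pplus p T)) (S : CDown X) : P S := by
  -- every `φ` is the largest element of some constructed set
  have principal : ∀ φ : Dist (Option X), ∃ D : CDown X, P D ∧ φ ∈ D.1.carrier ∧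
      ∀ ψ ∈ D.1.carrier, ∀ x : X, ψ.weights (some x) ≤ φ.weights (some x) := by
    have hconv : IsConvexSet ℝ {φ : Dist (Option X) | ∃ D : CDown X, P D ∧ φ ∈ D.1.carrier ∧
        ∀ ψ ∈ D.1.carrier, ∀ x : X, ψ.weights (some x) ≤ φ.weights (some x)} := by
      refine isConvexSet_of_comb_mem ?_
      rintro p φ ⟨D, hD, hφ, hle⟩ ψ ⟨E, hE, hψ, hle'⟩
      refine ⟨D.pplus p E, pplus p D E hD hE, ⟨φ, hφ, ψ, hψ, rfl⟩, ?_⟩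
      rintro _ ⟨φ', hφ', ψ', hψ', rfl⟩ x
      simp only [comb_weights]
      exact add_le_add (mul_le_mul_of_nonneg_left (hle _ hφ' x) p.2.1.le)
        (mul_le_mul_of_nonneg_left (hle' _ hψ' x) (sub_nonneg.2 p.2.2.le))
    intro φ
    rw [← mix_dirac φ]
    refine hconv.iConvexComb_mem fun o _ => ?_
    cases o with
    | none =>
      refine ⟨_, star, rfl, ?_⟩
      rintro _ rfl x
      exact le_rfl
    | some y =>
      refine ⟨_, unit y, subset_convexHull_self (Set.mem_insert _ _), fun ψ hψ x => ?_⟩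
      obtain ⟨r, rfl⟩ := (mem_cc_pair y ψ).1 hψ
      classical
      by_cases h : y = x <;> simp [partialDirac, h, r.2.2]
  have finite : ∀ G : Set (Dist (Option X)), G.Finite → G.Nonempty → G ⊆ S.1.carrier →
      ∃ D : CDown X, P D ∧ G ⊆ D.1.carrier ∧ D.1.carrier ⊆ S.1.carrier := by
    intro G hG hne
    lift G to Finset (Dist (Option X)) using hG
    rw [Finset.coe_nonempty] at hne
    induction hne using Finset.Nonempty.cons_induction with
    | singleton φ =>
      intro hG
      obtain ⟨D, hD, hφ, hle⟩ := principal φ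
      rw [Finset.coe_singleton] at hG ⊢
      rw [Set.singleton_subset_iff] at hG
      exact ⟨D, hD, Set.singleton_subset_iff.2 hφ, fun ψ hψ => S.2 φ hG (hle ψ hψ)⟩
    | cons φ G _ _ ih =>
      intro hG
      rw [Finset.coe_cons, Set.insert_subset_iff] at hG
      obtain ⟨D, hD, hφ, hle⟩ := principal φ
      obtain ⟨E, hE, hGE, hES⟩ := ih hG.2
      refine ⟨D.oplus E, oplus D E hD hE, ?_, CDown.oplus_subset S.1.convex
        (fun ψ hψ => S.2 φ hG.1 (hle ψ hψ)) hES⟩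
      rw [Finset.coe_cons, Set.insert_subset_iff]
      exact ⟨D.left_subset_oplus E hφ, hGE.trans (D.right_subset_oplus E)⟩
  obtain ⟨F, hF, h⟩ := S.1.finGen
  obtain ⟨D, hD, hFD, hDS⟩ := finite F hF (by
    exact convexHull_nonempty.1 (h ▸ S.1.nonempty))
    (h ▸ subset_convexHull_self)
  have : S = D := CDown.ext <| CSet.ext <|
    Set.Subset.antisymm (h ▸ Convexity.convexHull_min hFD D.1.convex) hDS
  exact this ▸ hD

/-- Uniqueness of the extension of a function along the unit. -/
lemma CDown.hom_congr {X : Type u} {B : ConvSemilatBot.{u}}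
    {f g : ConvSemilatBot.Hom (CDown.free X) B}
    (h : ∀ x, f.toFun (CDown.unit x) = g.toFun (CDown.unit x)) (S : CDown X) :
    f.toFun S = g.toFun S := by
  refine CDown.free_induction (P := fun S => f.toFun S = g.toFun S) h ?_ ?_ ?_ S
  · exact f.map_star.trans g.map_star.symm
  · intro S T hS hT
    exact (f.map_oplus S T).trans ((congrArg₂ _ hS hT).trans (g.map_oplus S T).symm)
  · intro p S T hS hT
    exact (f.map_pplus p S T).trans ((congrArg₂ _ hS hT).trans (g.map_pplus p S T).symm)

/-! ### Barycentres in a convex semilattice -/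

open scoped NNReal

namespace ConvSemilatBot

variable {B : ConvSemilatBot.{u}}

/-- The cone over a convex semilattice: a formal apex `0` and the points `r x` with `r > 0`. It is
a module over the non-negative reals, so that finite weighted sums in it are independent of the
order of summation. -/
inductive Cone (B : ConvSemilatBot.{u}) : Type u where
  | zero : Cone B
  | pt (r : ℝ≥0) (hr : 0 < r) (x : B.carrier) : Cone B

namespace Cone

/-- The weight `r / (r + s)` of the first summand in `r x + s y`. -/
def ratio (r s : ℝ≥0) (hr : 0 < r) (hs : 0 < s) : Prob :=
  ⟨(r / (r + s) : ℝ≥0), by positivity, by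
    rw [← NNReal.coe_one, NNReal.coe_lt_coe, div_lt_one (by positivity)]
    exact lt_add_of_pos_right r hs⟩

lemma pt_congr {r s : ℝ≥0} {hr : 0 < r} {hs : 0 < s} {x y : B.carrier} (h : r = s) (h' : x = y) :
    (pt r hr x : Cone B) = pt s hs y := by
  subst h h'
  rfl

instance : Zero (Cone B) := ⟨zero⟩

/-- `r x + s y` is `r + s` times the mixture of `x` and `y` in the ratio `r : s`. -/
instance : Add (Cone B) where
  add
    | zero, v => v
    | pt r hr x, zero => pt r hr x
    | pt r hr x, pt s hs y => pt (r + s) (add_pos hr hs) (B.pplus (ratio r s hr hs) x y)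

lemma pt_add_pt (r s : ℝ≥0) (hr : 0 < r) (hs : 0 < s) (x y : B.carrier) :
    (pt r hr x + pt s hs y : Cone B) =
      pt (r + s) (add_pos hr hs) (B.pplus (ratio r s hr hs) x y) := rfl

protected lemma zero_add (v : Cone B) : 0 + v = v := rfl

protected lemma add_zero (v : Cone B) : v + 0 = v := by
  cases v <;> rfl

protected lemma add_comm (v w : Cone B) : v + w = w + v := by
  cases v with
  | zero => exact (Cone.add_zero w).symm
  | pt r hr x =>
    cases w with
    | zero => rfl
    | pt s hs y =>
      rw [pt_add_pt, pt_add_pt, B.pplus_comm]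
      refine pt_congr (add_comm r s) ?_
      congr 1
      ext
      simp only [ratio, Prob.compl]
      push_cast
      have : (r : ℝ) + s ≠ 0 := by positivity
      have : (s : ℝ) + r ≠ 0 := by positivity
      field_simp
      ring

protected lemma add_assoc (v w z : Cone B) : v + w + z = v + (w + z) := by
  cases v with
  | zero => rfl
  | pt r hr x =>
    cases w with
    | zero => rfl
    | pt s hs y =>
      cases z with
      | zero => rfl
      | pt t ht z =>
        rw [pt_add_pt, pt_add_pt, pt_add_pt, pt_add_pt, B.pplus_assoc]
        have h1 : (r : ℝ) + s ≠ 0 := by positivity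
        have h2 : (s : ℝ) + t ≠ 0 := by positivity
        have h3 : (r : ℝ) + s + t ≠ 0 := by positivity
        have h4 : (r : ℝ) + (s + t) ≠ 0 := by positivity
        have e1 : (ratio (r + s) t (add_pos hr hs) ht).mul (ratio r s hr hs) =
            ratio r (s + t) hr (add_pos hs ht) := by
          ext
          simp only [ratio, Prob.mul]
          push_cast
          field_simp
          ring
        have e2 : (ratio (r + s) t (add_pos hr hs) ht).assoc (ratio r s hr hs) =
            ratio s t hs ht := by
          ext
          have h5 : 1 - ((r : ℝ) + s) / (r + s + t) * (r / (r + s)) = (s + t) / (r + s + t) := by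
            field_simp
            ring
          simp only [ratio, Prob.assoc]
          push_cast
          rw [h5]
          field_simp
          ring
        rw [e1, e2]
        exact pt_congr (add_assoc r s t) rfl

instance : AddCommMonoid (Cone B) where
  zero_add := Cone.zero_add
  add_zero := Cone.add_zero
  add_comm := Cone.add_comm
  add_assoc := Cone.add_assoc
  nsmul := nsmulRec

open scoped Classical in
instance : SMul ℝ≥0 (Cone B) where
  smul c
    | zero => zero
    | pt r hr x => if hc : 0 < c then pt (c * r) (mul_pos hc hr) x else zero

lemma smul_pt {c : ℝ≥0} (hc : 0 < c) (r : ℝ≥0) (hr : 0 < r) (x : B.carrier) :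
    (c • pt r hr x : Cone B) = pt (c * r) (mul_pos hc hr) x := dif_pos hc

protected lemma zero_smul (v : Cone B) : (0 : ℝ≥0) • v = 0 := by
  cases v with
  | zero => rfl
  | pt r hr x => exact dif_neg (lt_irrefl 0)

protected lemma smul_zero (c : ℝ≥0) : c • (0 : Cone B) = 0 := rfl

/-- Distributivity over the scalars is the idempotence of the mixtures. -/
instance : Module ℝ≥0 (Cone B) where
  one_smul v := by
    cases v with
    | zero => rfl
    | pt r hr x =>
      rw [smul_pt one_pos]
      exact pt_congr (one_mul r) rfl
  mul_smul c d v := by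
    rcases eq_zero_or_pos c with rfl | hc
    · rw [zero_mul, Cone.zero_smul, Cone.zero_smul]
    rcases eq_zero_or_pos d with rfl | hd
    · rw [mul_zero, Cone.zero_smul, Cone.smul_zero]
    cases v with
    | zero => rfl
    | pt r hr x =>
      rw [smul_pt hd, smul_pt hc, smul_pt (mul_pos hc hd)]
      exact pt_congr (mul_assoc c d r) rfl
  smul_zero := Cone.smul_zero
  zero_smul := Cone.zero_smul
  smul_add c v w := by
    rcases eq_zero_or_pos c with rfl | hc
    · simp only [Cone.zero_smul, Cone.zero_add]
    cases v with
    | zero => rfl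
    | pt r hr x =>
      cases w with
      | zero => exact (Cone.add_zero _).symm
      | pt s hs y =>
        rw [pt_add_pt, smul_pt hc, smul_pt hc, smul_pt hc, pt_add_pt]
        refine pt_congr (mul_add c r s) ?_
        congr 1
        ext
        simp only [ratio]
        push_cast
        have : (c : ℝ) ≠ 0 := by positivity
        have : (r : ℝ) + s ≠ 0 := by positivity
        field_simp
  add_smul c d v := by
    rcases eq_zero_or_pos c with rfl | hc
    · rw [Cone.zero_smul, zero_add, Cone.zero_add]
    rcases eq_zero_or_pos d with rfl | hd
    · rw [Cone.zero_smul, add_zero, Cone.add_zero]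
    cases v with
    | zero => rfl
    | pt r hr x =>
      rw [smul_pt hc, smul_pt hd, smul_pt (add_pos hc hd), pt_add_pt, B.pplus_idem]
      exact pt_congr (add_mul c d r) rfl

/-- The total weight of a point of the cone. -/
def weight : Cone B →ₗ[ℝ≥0] ℝ≥0 where
  toFun
    | zero => 0
    | pt r _ _ => r
  map_add' v w := by
    cases v with
    | zero => exact (zero_add _).symm
    | pt r hr x =>
      cases w with
      | zero => exact (add_zero _).symm
      | pt s hs y => rfl
  map_smul' c v := by
    rcases eq_zero_or_pos c with rfl | hc
    · rw [zero_smul, map_zero, zero_smul]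
    cases v with
    | zero => exact (mul_zero c).symm
    | pt r hr x => rw [smul_pt hc]; rfl

/-- The inclusion of a convex semilattice in its cone as the points of weight `1`. -/
def ι (x : B.carrier) : Cone B := pt 1 one_pos x

lemma ι_injective : Function.Injective (ι : B.carrier → Cone B) := fun x y h => by
  injection h

lemma exists_ι_eq {v : Cone B} (h : weight v = 1) : ∃ x, ι x = v := by
  cases v with
  | zero => exact absurd h zero_ne_one
  | pt r hr x => exact ⟨x, pt_congr (Eq.symm h) rfl⟩

lemma ι_pplus (p : Prob) (x y : B.carrier) :
    ι (B.pplus p x y) =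
      p.1.toNNReal • ι x + (1 - p.1).toNNReal • (ι y : Cone B) := by
  have hp : 0 < p.1.toNNReal := Real.toNNReal_pos.2 p.2.1
  have hp' : 0 < (1 - p.1).toNNReal := Real.toNNReal_pos.2 (sub_pos.2 p.2.2)
  have h : p.1.toNNReal + (1 - p.1).toNNReal = 1 := by
    rw [← Real.toNNReal_add p.2.1.le (sub_nonneg.2 p.2.2.le), add_sub_cancel, Real.toNNReal_one]
  rw [ι, ι, ι, smul_pt hp, smul_pt hp', pt_add_pt]
  refine pt_congr (by rw [mul_one, mul_one, h]) ?_
  congr 1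
  ext
  simp [ratio, h, p.2.1.le]

end Cone

/-- The weights of a distribution as non-negative reals. -/
def nnWeights {X : Type u} (φ : Dist X) : X →₀ ℝ≥0 :=
  φ.weights.mapRange Real.toNNReal Real.toNNReal_zero

lemma nnWeights_apply {X : Type u} (φ : Dist X) (x : X) :
    nnWeights φ x = (φ.weights x).toNNReal := rfl

lemma nnWeights_dirac {X : Type u} (x : X) : nnWeights (dirac x) = Finsupp.single x 1 := by
  simp [nnWeights]

lemma nnWeights_comb {X : Type u} (p : Prob) (φ ψ : Dist X) :
    nnWeights (comb p φ ψ) =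
      p.1.toNNReal • nnWeights φ + (1 - p.1).toNNReal • nnWeights ψ := by
  ext x
  have hp := p.2.1.le
  have hp' : 0 ≤ 1 - p.1 := sub_nonneg.2 p.2.2.le
  have h := φ.nonneg x
  have h' := ψ.nonneg x
  simp only [Finsupp.add_apply, Finsupp.smul_apply, nnWeights_apply, comb_weights, smul_eq_mul]
  rw [Real.toNNReal_add (mul_nonneg hp h) (mul_nonneg hp' h'), Real.toNNReal_mul hp,
    Real.toNNReal_mul hp']

lemma nnWeights_total {X : Type u} (φ : Dist X) : (nnWeights φ).sum (fun _ r => r) = 1 := by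
  rw [nnWeights, Finsupp.sum_mapRange_index (fun _ => rfl), Finsupp.sum,
    ← Real.toNNReal_sum_of_nonneg fun x _ => φ.nonneg x]
  exact (congrArg Real.toNNReal φ.total).trans Real.toNNReal_one

/-- The weighted sum in the cone of a subdistribution on a convex semilattice, the missing weight
being put on `⋆`. -/
def coneSum (φ : Dist (Option B.carrier)) : Cone B :=
  Finsupp.linearCombination ℝ≥0 (fun o : Option B.carrier => Cone.ι (o.getD B.star)) (nnWeights φ)

lemma weight_coneSum (φ : Dist (Option B.carrier)) : Cone.weight (coneSum φ) = 1 := by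
  rw [coneSum, Finsupp.linearCombination_apply, map_finsuppSum, ← nnWeights_total φ]
  refine Finsupp.sum_congr fun o _ => ?_
  rw [map_smul]
  exact mul_one _

/-- The barycentre of a subdistribution on a convex semilattice with bottom, the missing weight
being put on `⋆`. -/
def eval (φ : Dist (Option B.carrier)) : B.carrier :=
  (Cone.exists_ι_eq (weight_coneSum φ)).choose

lemma ι_eval (φ : Dist (Option B.carrier)) : Cone.ι (eval φ) = coneSum φ :=
  (Cone.exists_ι_eq (weight_coneSum φ)).choose_spec

lemma eval_dirac (o : Option B.carrier) : eval (dirac o) = o.getD B.star := by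
  apply Cone.ι_injective
  rw [ι_eval, coneSum, nnWeights_dirac, Finsupp.linearCombination_single, one_smul]

lemma eval_comb (p : Prob) (φ ψ : Dist (Option B.carrier)) :
    eval (comb p φ ψ) = B.pplus p (eval φ) (eval ψ) := by
  apply Cone.ι_injective
  rw [Cone.ι_pplus, ι_eval, ι_eval, ι_eval, coneSum, nnWeights_comb, map_add, map_smul, map_smul]
  rfl

/-! ### Suprema of convex sets -/

/-- The order of the underlying join-semilattice: `x ≤ y` when `x ⊕ y = y`. -/
instance : SemilatticeSup B.carrier :=
  letI : Max B.carrier := ⟨B.oplus⟩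
  SemilatticeSup.mk' B.oplus_comm (fun x y z => (B.oplus_assoc x y z).symm) B.oplus_idem

lemma star_le (x : B.carrier) : B.star ≤ x := by
  rw [← sup_eq_right, sup_comm]
  exact B.oplus_star x

lemma pplus_sup (p : Prob) (x y z : B.carrier) :
    B.pplus p x (y ⊔ z) = B.pplus p x y ⊔ B.pplus p x z :=
  B.pplus_oplus p x y z

lemma sup_pplus (p : Prob) (x y z : B.carrier) :
    B.pplus p (x ⊔ y) z = B.pplus p x z ⊔ B.pplus p y z := by
  rw [B.pplus_comm, pplus_sup, ← B.pplus_comm, ← B.pplus_comm]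

lemma pplus_le_pplus (p : Prob) {x x' y y' : B.carrier} (hx : x ≤ x') (hy : y ≤ y') :
    B.pplus p x y ≤ B.pplus p x' y' :=
  calc B.pplus p x y ≤ B.pplus p x y' := by
        rw [← sup_eq_right, ← pplus_sup, sup_eq_right.2 hy]
    _ ≤ B.pplus p x' y' := by rw [← sup_eq_right, ← sup_pplus, sup_eq_right.2 hx]

/-- The sets bounded above by a point are convex, since mixtures are monotone and idempotent. -/
lemma isConvexSet_eval_le (s : B.carrier) :
    IsConvexSet ℝ {φ : Dist (Option B.carrier) | eval φ ≤ s} :=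
  isConvexSet_of_comb_mem fun p φ hφ ψ hψ => by
    have := pplus_le_pplus p hφ hψ
    rwa [← eval_comb, B.pplus_idem] at this

/-- A finitely generated convex set has a supremum, namely the join of its generators, which any
property that is stable under joins inherits from the points of the set. -/
lemma exists_isLUB_eval (S : CSet (Option B.carrier)) :
    ∃ s : B.carrier, IsLUB (eval '' S.carrier) s ∧
      ∀ P : B.carrier → Prop, (∀ φ ∈ S.carrier, P (eval φ)) →
        (∀ x y, P x → P y → P (x ⊔ y)) → P s := by
  obtain ⟨F, hF, h⟩ := S.finGen
  have hne : F.Nonempty := convexHull_nonempty.1 (h ▸ S.nonempty)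
  lift F to Finset (Dist (Option B.carrier)) using hF
  rw [Finset.coe_nonempty] at hne
  have hFS : (F : Set (Dist (Option B.carrier))) ⊆ S.carrier := h ▸ subset_convexHull_self
  refine ⟨F.sup' hne eval, ⟨?_, ?_⟩, fun P hP hsup => ?_⟩
  · rintro _ ⟨φ, hφ, rfl⟩
    rw [h] at hφ
    exact Convexity.convexHull_min (fun ψ hψ => Finset.le_sup' eval hψ)
      (isConvexSet_eval_le _) hφ
  · exact fun t ht => Finset.sup'_le hne eval fun φ hφ => ht ⟨φ, hFS hφ, rfl⟩
  · exact Finset.sup'_induction hne eval (fun x hx y hy => hsup x y hx hy)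
      fun φ hφ => hP φ (hFS hφ)

/-- The supremum of the barycentres of the elements of a convex set of subdistributions. -/
def structMap (S : CDown B.carrier) : B.carrier := (exists_isLUB_eval S.1).choose

lemma isLUB_structMap (S : CDown B.carrier) : IsLUB (eval '' S.1.carrier) (structMap S) :=
  (exists_isLUB_eval S.1).choose_spec.1

lemma structMap_induction {P : B.carrier → Prop} (S : CDown B.carrier)
    (h : ∀ φ ∈ S.1.carrier, P (eval φ)) (hsup : ∀ x y, P x → P y → P (x ⊔ y)) : P (structMap S) :=
  (exists_isLUB_eval S.1).choose_spec.2 P h hsup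

lemma eval_le_structMap {S : CDown B.carrier} {φ : Dist (Option B.carrier)}
    (h : φ ∈ S.1.carrier) :
    eval φ ≤ structMap S :=
  (isLUB_structMap S).1 ⟨φ, h, rfl⟩

lemma structMap_le_iff {S : CDown B.carrier} {t : B.carrier} :
    structMap S ≤ t ↔ S.1.carrier ⊆ {φ | eval φ ≤ t} := by
  rw [isLUB_le_iff (isLUB_structMap S), mem_upperBounds, Set.forall_mem_image]
  rfl

lemma structMap_unit (x : B.carrier) : structMap (CDown.unit x) = x := by
  apply le_antisymm
  · rw [structMap_le_iff]
    refine Convexity.convexHull_min ?_ (isConvexSet_eval_le x)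
    rintro _ (rfl | rfl)
    · exact (eval_dirac _).le
    · exact (eval_dirac _).trans_le (star_le x)
  · have : dirac (some x) ∈ (CDown.unit x).1.carrier :=
      subset_convexHull_self (Set.mem_insert _ _)
    simpa only [eval_dirac] using! eval_le_structMap this

/-- The supremum as a homomorphism; it extends the identity of `B` along the unit. -/
def structHom (B : ConvSemilatBot.{u}) : Hom (CDown.free B.carrier) B where
  toFun := structMap
  map_oplus S T := by
    apply le_antisymm
    · rw [structMap_le_iff]
      exact CDown.oplus_subset (isConvexSet_eval_le _)
        (fun φ hφ => (eval_le_structMap hφ).trans le_sup_left)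
        (fun φ hφ => (eval_le_structMap hφ).trans le_sup_right)
    · exact _root_.sup_le
        (structMap_le_iff.2 fun φ hφ => eval_le_structMap (S.left_subset_oplus T hφ))
        (structMap_le_iff.2 fun φ hφ => eval_le_structMap (S.right_subset_oplus T hφ))
  map_pplus p S T := by
    apply le_antisymm
    · rw [structMap_le_iff]
      rintro _ ⟨φ, hφ, ψ, hψ, rfl⟩
      exact (eval_comb p φ ψ).trans_le
        (pplus_le_pplus p (eval_le_structMap hφ) (eval_le_structMap hψ))
    -- mixtures distribute over the finite joins that compute the two suprema
    · refine structMap_induction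
        (P := fun x => B.pplus p x (structMap T) ≤ structMap (S.pplus p T)) S
        (fun φ hφ => ?_) fun x y hx hy => ?_
      · refine structMap_induction (P := fun y => B.pplus p (eval φ) y ≤ structMap (S.pplus p T)) T
          (fun ψ hψ => ?_) fun x y hx hy => ?_
        · rw [← eval_comb]
          exact eval_le_structMap (Set.mem_image2_of_mem hφ hψ)
        · rw [pplus_sup]
          exact _root_.sup_le hx hy
      · rw [sup_pplus]
        exact _root_.sup_le hx hy
  map_star := by
    apply le_antisymm
    · rw [structMap_le_iff]
      rintro _ rfl
      exact (eval_dirac none).le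
    · exact star_le _

lemma structMap_oplus_unit (x y : B.carrier) :
    structMap ((CDown.unit x).oplus (CDown.unit y)) = B.oplus x y := by
  have h : structMap ((CDown.unit x).oplus (CDown.unit y)) =
      B.oplus (structMap (CDown.unit x)) (structMap (CDown.unit y)) := B.structHom.map_oplus _ _
  rw [h, structMap_unit, structMap_unit]

lemma structMap_pplus_unit (p : Prob) (x y : B.carrier) :
    structMap ((CDown.unit x).pplus p (CDown.unit y)) = B.pplus p x y := by
  have h : structMap ((CDown.unit x).pplus p (CDown.unit y)) =
      B.pplus p (structMap (CDown.unit x)) (structMap (CDown.unit y)) :=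
    B.structHom.map_pplus p _ _
  rw [h, structMap_unit, structMap_unit]

end ConvSemilatBot

/-! ### Eilenberg–Moore algebras -/

/-- The structure map of an Eilenberg–Moore algebra, as a function. -/
def act (T : cDownMonad.{u}.Algebra) (S : CDown T.A) : T.A := T.a S

lemma act_unit (T : cDownMonad.{u}.Algebra) (x : T.A) : act T (CDown.unit x) = x :=
  ConcreteCategory.congr_hom T.unit x

lemma act_join (T : cDownMonad.{u}.Algebra) (S : CDown (CDown T.A)) :
    act T S.join = act T (S.map (act T)) := by
  have h := ConcreteCategory.congr_hom T.assoc S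
  exact h

/-- Multiplication and push-forward preserve the operation, so that the structure map preserves
it as well. -/
lemma act_oplus (T : cDownMonad.{u}.Algebra) (S S' : CDown T.A) :
    act T (S.oplus S') =
      act T ((CDown.unit (act T S)).oplus (CDown.unit (act T S'))) := by
  have h : ((CDown.unit S).oplus (CDown.unit S')).join =
      (CDown.unit S).join.oplus (CDown.unit S').join := (CDown.joinHom T.A).map_oplus _ _
  have h' : ((CDown.unit S).oplus (CDown.unit S')).map (act T) =
      ((CDown.unit S).map (act T)).oplus ((CDown.unit S').map (act T)) :=
    (CDown.mapHom (act T)).map_oplus _ _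
  rw [CDown.join_unit, CDown.join_unit] at h
  rw [CDown.map_unit, CDown.map_unit] at h'
  rw [← h, act_join, h']

lemma act_pplus (T : cDownMonad.{u}.Algebra) (p : Prob) (S S' : CDown T.A) :
    act T (S.pplus p S') =
      act T ((CDown.unit (act T S)).pplus p (CDown.unit (act T S'))) := by
  have h : ((CDown.unit S).pplus p (CDown.unit S')).join =
      (CDown.unit S).join.pplus p (CDown.unit S').join := (CDown.joinHom T.A).map_pplus p _ _
  have h' : ((CDown.unit S).pplus p (CDown.unit S')).map (act T) =
      ((CDown.unit S).map (act T)).pplus p ((CDown.unit S').map (act T)) :=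
    (CDown.mapHom (act T)).map_pplus p _ _
  rw [CDown.join_unit, CDown.join_unit] at h
  rw [CDown.map_unit, CDown.map_unit] at h'
  rw [← h, act_join, h']

lemma act_surjective (T : cDownMonad.{u}.Algebra) : Function.Surjective (act T) :=
  fun x => ⟨_, act_unit T x⟩

/-- The convex semilattice with bottom underlying an Eilenberg–Moore algebra. Its laws hold since
they hold in the free one, of which it is a quotient. -/
def ofAlgebra (T : cDownMonad.{u}.Algebra) : ConvSemilatBot.{u} where
  carrier := T.A
  oplus x y := act T ((CDown.unit x).oplus (CDown.unit y))
  pplus p x y := act T ((CDown.unit x).pplus p (CDown.unit y))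
  star := act T (CDown.star T.A)
  oplus_assoc x y z := by
    obtain ⟨S, rfl⟩ := act_surjective T x
    obtain ⟨S', rfl⟩ := act_surjective T y
    obtain ⟨S'', rfl⟩ := act_surjective T z
    simp only [← act_oplus]
    exact congrArg (act T) ((CDown.free T.A).oplus_assoc S S' S'')
  oplus_comm x y := congrArg (act T) ((CDown.free T.A).oplus_comm _ _)
  oplus_idem x := by
    obtain ⟨S, rfl⟩ := act_surjective T x
    simp only [← act_oplus]
    exact congrArg (act T) ((CDown.free T.A).oplus_idem S)
  pplus_assoc p q x y z := by
    obtain ⟨S, rfl⟩ := act_surjective T x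
    obtain ⟨S', rfl⟩ := act_surjective T y
    obtain ⟨S'', rfl⟩ := act_surjective T z
    simp only [← act_pplus]
    exact congrArg (act T) ((CDown.free T.A).pplus_assoc p q S S' S'')
  pplus_comm p x y := congrArg (act T) ((CDown.free T.A).pplus_comm p _ _)
  pplus_idem p x := by
    obtain ⟨S, rfl⟩ := act_surjective T x
    simp only [← act_pplus]
    exact congrArg (act T) ((CDown.free T.A).pplus_idem p S)
  pplus_oplus p x y z := by
    obtain ⟨S, rfl⟩ := act_surjective T x
    obtain ⟨S', rfl⟩ := act_surjective T y
    obtain ⟨S'', rfl⟩ := act_surjective T z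
    simp only [← act_pplus, ← act_oplus]
    exact congrArg (act T) ((CDown.free T.A).pplus_oplus p S S' S'')
  oplus_star x := by
    obtain ⟨S, rfl⟩ := act_surjective T x
    simp only [← act_oplus]
    exact congrArg (act T) ((CDown.free T.A).oplus_star S)

/-- The structure map of an algebra is a homomorphism from the free convex semilattice. -/
def algebraHom (T : cDownMonad.{u}.Algebra) :
    ConvSemilatBot.Hom (CDown.free T.A) (ofAlgebra T) where
  toFun := act T
  map_oplus := act_oplus T
  map_pplus := act_pplus T
  map_star := rfl

/-- The algebra structure on a convex semilattice with bottom. Both sides of the associativity law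
are homomorphisms from a free object, so it is enough to compare them on units. -/
def toAlgebra (B : ConvSemilatBot.{u}) : cDownMonad.{u}.Algebra where
  A := B.carrier
  a := ↾ConvSemilatBot.structMap
  unit := by
    ext x
    exact ConvSemilatBot.structMap_unit x
  assoc := by
    ext S
    exact CDown.hom_congr
      (f := (CDown.joinHom B.carrier ≫ B.structHom : CDown.free (CDown B.carrier) ⟶ B))
      (g := (CDown.mapHom ConvSemilatBot.structMap ≫ B.structHom :
        CDown.free (CDown B.carrier) ⟶ B)) (fun U => by
      change ConvSemilatBot.structMap (CDown.join (CDown.unit U)) =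
        ConvSemilatBot.structMap (CDown.map ConvSemilatBot.structMap (CDown.unit U))
      rw [CDown.join_unit, CDown.map_unit, ConvSemilatBot.structMap_unit]) S

lemma ofAlgebra_toAlgebra (B : ConvSemilatBot.{u}) : ofAlgebra (toAlgebra B) = B := by
  have h1 : (ofAlgebra (toAlgebra B)).oplus = B.oplus :=
    funext fun x => funext fun y => ConvSemilatBot.structMap_oplus_unit (B := B) x y
  have h2 : (ofAlgebra (toAlgebra B)).pplus = B.pplus :=
    funext fun p => funext fun x => funext fun y =>
      ConvSemilatBot.structMap_pplus_unit (B := B) p x y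
  have h3 : (ofAlgebra (toAlgebra B)).star = B.star := B.structHom.map_star
  cases B
  simp only [ofAlgebra] at h1 h2 h3 ⊢
  congr

/-- The structure map of an algebra and the supremum are both homomorphisms from the free object
that are the identity on units. -/
lemma toAlgebra_ofAlgebra (T : cDownMonad.{u}.Algebra) : toAlgebra (ofAlgebra T) = T := by
  have h : (toAlgebra (ofAlgebra T)).a = T.a := by
    ext S
    exact CDown.hom_congr (f := (ofAlgebra T).structHom) (g := algebraHom T) (fun x =>
      (ConvSemilatBot.structMap_unit (B := ofAlgebra T) x).trans
        (act_unit T x).symm) S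
  cases T
  simp only [toAlgebra] at h ⊢
  congr

/-- The comparison functor: a morphism of algebras preserves the operations, since push-forward
does. -/
def ofAlgebraFunctor : cDownMonad.{u}.Algebra ⥤ ConvSemilatBot.{u} where
  obj := ofAlgebra
  map {T T'} f :=
    have h (S : CDown T.A) : act T' (CDown.map f.f S) = f.f (T.a S) :=
      ConcreteCategory.congr_hom f.h S
    { toFun := f.f
      map_oplus x y := by
        refine (h _).symm.trans (congrArg (act T') ?_)
        refine ((CDown.mapHom f.f).map_oplus _ _).trans ?_
        exact congrArg₂ _ (CDown.map_unit f.f x) (CDown.map_unit f.f y)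
      map_pplus p x y := by
        refine (h _).symm.trans (congrArg (act T') ?_)
        refine ((CDown.mapHom f.f).map_pplus p _ _).trans ?_
        exact congrArg₂ _ (CDown.map_unit f.f x) (CDown.map_unit f.f y)
      map_star := (h _).symm.trans (congrArg (act T') (CDown.mapHom f.f).map_star) }

instance : ofAlgebraFunctor.{u}.Faithful where
  map_injective {T T'} f g h := by
    ext x
    exact congrFun (congrArg ConvSemilatBot.Hom.toFun h) x

/-- A homomorphism commutes with the structure maps, by uniqueness of extensions along the
unit. -/
instance : ofAlgebraFunctor.{u}.Full where
  map_surjective {T T'} g := by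
    let f : T.A → T'.A := g.toFun
    have h (S : CDown T.A) : act T' (CDown.map f S) = f (act T S) :=
      CDown.hom_congr
        (f := (CDown.mapHom f ≫ algebraHom T' : CDown.free T.A ⟶ ofAlgebra T'))
        (g := (algebraHom T ≫ g : CDown.free T.A ⟶ ofAlgebra T')) (fun x => by
          change act T' (CDown.map f (CDown.unit x)) = f (act T (CDown.unit x))
          rw [CDown.map_unit, act_unit, act_unit]) S
    exact ⟨{ f := ↾f, h := by ext S; exact h S }, rfl⟩

instance : ofAlgebraFunctor.{u}.IsIso where
  bijective_obj := Function.bijective_iff_has_inverse.2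
    ⟨toAlgebra, toAlgebra_ofAlgebra, ofAlgebra_toAlgebra⟩

end ConvexSets

end

theorem mainTheorem2 :
    ∃ P : CategoryTheory.IsoCat ConvexSets.cDownMonad.{u}.Algebra ConvexSets.ConvSemilatBot.{u},
      P.functor ⋙ ConvexSets.ConvSemilatBot.forget = ConvexSets.cDownMonad.{u}.forget :=
  ⟨ConvexSets.ofAlgebraFunctor.asIsomorphism, rfl⟩
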